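/- Let $\mathbb K$ be a field of positive characteristic $p$, let $n\ge 1$, let $\mathcal V$ be the category of finite-dimensional $\mathbb K$-vector spaces and ${}_{\mathfrak S_n}\mathcal V$ that of finite-dimensional $\mathbb K$-representations of the symmetric group $\mathfrak S_n$. Write $(-)^\vee$ for the dual vector space or the contragredient representation. Let $\mathcal A_n$ be the category of $\mathbb K$-linear functors ${}_{\mathfrak S_n}\mathcal V\to\mathcal V$. For $M$ in ${}_{\mathfrak S_n}\mathcal V$ put $\mathbf h_M=\mathrm{Hom}_{\mathfrak S_n}(M,-)$ and $\mathbf t_M=M\otimes_{\mathfrak S_n}(-)$ in $\mathcal A_n$. For a subgroup $H\le\mathfrak S_n$ let $\mathrm H_0(H,-)$ and $\mathrm H^0(H,-)$ in $\mathcal A_n$ be the functors of $H$-coinvariants and of $H$-invariants. For a vector space $X$ put $\Gamma^n(X)=(X^{\otimes n})^{\mathfrak S_n}$. Let $\Gamma^n\mathcal V$ be the category with the objects of $\mathcal V$, with morphism spaces $\Gamma^n(\mathrm{Hom}_{\mathbb K}(V,W))$, and with the composition induced by factorwise composition in $\mathrm{Hom}_{\mathbb K}(V,W)^{\otimes n}$.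 Let $\mathcal P_n$ be the category of homogeneous strict polynomial functors of degree $n$, that is, of $\mathbb K$-linear functors $\Gamma^n\mathcal V\to\mathcal V$. The assignment $V\mapsto V^{\otimes n}$ is a $\mathbb K$-linear functor $\Gamma^n\mathcal V\to{}_{\mathfrak S_n}\mathcal V$; let $j^*:\mathcal A_n\to\mathcal P_n$ be precomposition with it. Both categories have the duality $(\mathbb D F)(X)=F(X^\vee)^\vee$. Define functors $j_*,j_!:\mathcal P_n\to\mathcal A_n$ by $$j_*(F)(M)=\mathrm{Hom}_{\mathcal P_n}(j^*\mathbf h_M,F),\qquad j_!(F)=\mathbb D(j_*(\mathbb D F)).$$ Let $S^m=j^*\mathrm H_0(\mathfrak S_m,-)$ and $\Gamma^m=j^*\mathrm H^0(\mathfrak S_m,-)$ in $\mathcal P_m$ be the symmetric and the divided power functors. For a partition $\lambda=(n_1\ge\dots\ge n_k>0)$ of $n$ let $S^\lambda=S^{n_1}\otimes\cdots\otimes S^{n_k}$ and $\Gamma^\lambda=\Gamma^{n_1}\otimes\cdots\otimes\Gamma^{n_k}$ in $\mathcal P_n$, where the tensor product $\mathcal P_a\times\mathcal P_b\to\mathcal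 P_{a+b}$ is $(F\otimes G)(V)=F(V)\otimes G(V)$ with $\Gamma^{a+b}(\mathrm{Hom}(V,W))$ acting through the canonical inclusion $\Gamma^{a+b}\to\Gamma^a\otimes\Gamma^b$. Let $\mathfrak S_\lambda\cong\mathfrak S_{n_1}\times\cdots\times\mathfrak S_{n_k}$ be the Young subgroup of $\mathfrak S_n$ of the permutations preserving the consecutive blocks of lengths $n_1,\dots,n_k$, and let $\mathbb K[\mathfrak S_n/\mathfrak S_\lambda]$ be the permutation representation. **Lemma.** For every partition $\lambda$ of $n$ there are isomorphisms in $\mathcal A_n$ (that is, natural isomorphisms of functors) $$j_*(S^\lambda)\cong\mathrm H_0(\mathfrak S_\lambda,-)\cong\mathbf t_{\mathbb K[\mathfrak S_n/\mathfrak S_\lambda]},\qquad j_!(\Gamma^\lambda)\cong\mathrm H^0(\mathfrak S_\lambda,-)\cong\mathbf h_{\mathbb K[\mathfrak S_n/\mathfrak S_\lambda]}.$$ Moreover there are $\mathbb K$-linear isomorphisms, for all partitions $\lambda,\mu$ of $n$, $$\mathrm{Hom}_{\mathcal P_n}(S^\lambda,S^\mu)\cong\mathrm{Hom}_{\mathfrak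 S_n}(\mathbb K[\mathfrak S_n/\mathfrak S_\lambda],\mathbb K[\mathfrak S_n/\mathfrak S_\mu])\cong\mathrm{Hom}_{\mathcal P_n}(\Gamma^\mu,\Gamma^\lambda),$$ which can be chosen for all $\lambda,\mu$ at once so that the first one is compatible with composition and the second one reverses composition. -/

import Mathlib

universe u

open CategoryTheory TensorProduct

noncomputable section

namespace StrictPoly

section Powers

variable (K : Type u) [Field K]

/-- The action of the symmetric group on `X^{⊗ n}` by permuting the factors. -/
def permRep (n : ℕ) (X : Type u) [AddCommGroup X] [Module K X] :
    Representation K (Equiv.Perm (Fin n)) (⨂[K]^n X) where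
  toFun σ := (PiTensorProduct.reindex K (fun _ : Fin n => X) σ).toLinearMap
  map_one' := by
    ext x
    simp only [LinearMap.compMultilinearMap_apply, LinearEquiv.coe_coe,
      PiTensorProduct.reindex_tprod]
    rfl
  map_mul' σ τ := by
    ext x
    simp only [LinearMap.compMultilinearMap_apply, LinearEquiv.coe_coe, Module.End.mul_apply,
      PiTensorProduct.reindex_tprod]
    rfl

/-- The divided power `Γⁿ(X) = H⁰(𝔖ₙ, X^{⊗ n})`. -/
abbrev DivPow (n : ℕ) (X : Type u) [AddCommGroup X] [Module K X] : Submodule K (⨂[K]^n X) :=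
  (permRep K n X).invariants

variable {K}
variable {n : ℕ} {U V W Z X Y : Type u} [AddCommGroup U] [Module K U] [AddCommGroup V] [Module K V]
  [AddCommGroup W] [Module K W] [AddCommGroup Z] [Module K Z]
  [AddCommGroup X] [Module K X] [AddCommGroup Y] [Module K Y]

lemma permRep_tprod (σ : Equiv.Perm (Fin n)) (x : Fin n → X) :
    permRep K n X σ (PiTensorProduct.tprod K x) = PiTensorProduct.tprod K (fun i => x (σ.symm i)) :=
  PiTensorProduct.reindex_tprod _ _

/-- Composition of linear maps, extended factorwise to tensor powers of spaces of linear maps. -/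
def powComp (n : ℕ) : (⨂[K]^n (V →ₗ[K] W)) →ₗ[K] (⨂[K]^n (U →ₗ[K] V)) →ₗ[K] ⨂[K]^n (U →ₗ[K] W) :=
  PiTensorProduct.map₂ (fun _ : Fin n => LinearMap.llcomp K U V W)

lemma powComp_tprod (f : Fin n → V →ₗ[K] W) (g : Fin n → U →ₗ[K] V) :
    powComp n (PiTensorProduct.tprod K f) (PiTensorProduct.tprod K g) =
      PiTensorProduct.tprod K (fun i => f i ∘ₗ g i) := by
  simp only [powComp, PiTensorProduct.map₂_tprod_tprod]
  rfl

lemma ind {p : (⨂[K]^n X) → Prop} (z : ⨂[K]^n X)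
    (h : ∀ x : Fin n → X, p (PiTensorProduct.tprod K x)) (hs : ∀ (c : K) x, p x → p (c • x))
    (ha : ∀ x y, p x → p y → p (x + y)) : p z :=
  PiTensorProduct.induction_on z (fun r f => hs r _ (h f)) (fun x y => ha x y)

lemma permRep_powComp (σ : Equiv.Perm (Fin n)) (f : ⨂[K]^n (V →ₗ[K] W)) (g : ⨂[K]^n (U →ₗ[K] V)) :
    permRep K n _ σ (powComp n f g) = powComp n (permRep K n _ σ f) (permRep K n _ σ g) := by
  induction f using ind with
  | h f =>
    induction g using ind with
    | h g => simp only [permRep_tprod, powComp_tprod]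
    | hs c x hx => simp only [map_smul, hx]
    | ha x y hx hy => simp only [map_add, hx, hy]
  | hs c x hx => simp only [map_smul, hx, LinearMap.smul_apply]
  | ha x y hx hy => simp only [map_add, hx, hy, LinearMap.add_apply]

lemma powComp_assoc (h : ⨂[K]^n (W →ₗ[K] Z)) (f : ⨂[K]^n (V →ₗ[K] W)) (g : ⨂[K]^n (U →ₗ[K] V)) :
    powComp n (powComp n h f) g = powComp n h (powComp n f g) := by
  induction h using ind with
  | h h =>
    induction f using ind with
    | h f =>
      induction g using ind with
      | h g => simp only [powComp_tprod, LinearMap.comp_assoc]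
      | hs c x hx => simp only [map_smul, hx]
      | ha x y hx hy => simp only [map_add, hx, hy]
    | hs c x hx => simp only [map_smul, hx, LinearMap.smul_apply]
    | ha x y hx hy => simp only [map_add, hx, hy, LinearMap.add_apply]
  | hs c x hx => simp only [map_smul, hx, LinearMap.smul_apply]
  | ha x y hx hy => simp only [map_add, hx, hy, LinearMap.add_apply]

/-- The element `γ(x) = x^{⊗ n}` of `Γⁿ(X)`. -/
def divPow (n : ℕ) (x : X) : DivPow K n X :=
  ⟨PiTensorProduct.tprod K (fun _ => x), fun σ => permRep_tprod σ _⟩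

lemma powComp_id (f : ⨂[K]^n (V →ₗ[K] W)) :
    powComp n f (PiTensorProduct.tprod K (fun _ => LinearMap.id)) = f := by
  induction f using ind with
  | h f => simp only [powComp_tprod, LinearMap.comp_id]
  | hs c x hx => simp only [map_smul, hx, LinearMap.smul_apply]
  | ha x y hx hy => simp only [map_add, hx, hy, LinearMap.add_apply]

lemma id_powComp (f : ⨂[K]^n (V →ₗ[K] W)) :
    powComp n (PiTensorProduct.tprod K (fun _ => LinearMap.id)) f = f := by
  induction f using ind with
  | h f => simp only [powComp_tprod, LinearMap.id_comp]
  | hs c x hx => simp only [map_smul, hx]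
  | ha x y hx hy => simp only [map_add, hx, hy]

/-- The composition law `Γⁿ(Hom(V,W)) ⊗ Γⁿ(Hom(U,V)) → Γⁿ(Hom(U,W))`. -/
def divComp (n : ℕ) :
    DivPow K n (V →ₗ[K] W) →ₗ[K] DivPow K n (U →ₗ[K] V) →ₗ[K] DivPow K n (U →ₗ[K] W) :=
  LinearMap.mk₂ K (fun f g => ⟨powComp n f.1 g.1, fun σ => by
      rw [permRep_powComp, f.2 σ, g.2 σ]⟩)
    (fun _ _ _ => Subtype.ext (by simp)) (fun _ _ _ => Subtype.ext (by simp))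
    (fun _ _ _ => Subtype.ext (by simp)) (fun _ _ _ => Subtype.ext (by simp))

lemma divComp_coe (f : DivPow K n (V →ₗ[K] W)) (g : DivPow K n (U →ₗ[K] V)) :
    (divComp n f g : ⨂[K]^n (U →ₗ[K] W)) = powComp n f.1 g.1 := rfl

/-- The linear map `Γⁿ(X) → Γⁿ(Y)` induced by a linear map `X → Y`. -/
def divMap (n : ℕ) (f : X →ₗ[K] Y) : DivPow K n X →ₗ[K] DivPow K n Y :=
  (PiTensorProduct.map (fun _ : Fin n => f)).restrict fun x hx σ => by
    have : permRep K n Y σ ∘ₗ PiTensorProduct.map (fun _ : Fin n => f) =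
        PiTensorProduct.map (fun _ : Fin n => f) ∘ₗ permRep K n X σ := by
      ext x
      simp only [LinearMap.compMultilinearMap_apply, LinearMap.comp_apply, permRep_tprod,
        PiTensorProduct.map_tprod]
    have h2 := LinearMap.congr_fun this x
    simp only [LinearMap.comp_apply] at h2
    rw [h2, hx σ]

/-- The linear map `V^{⊗ n} → W^{⊗ n}` given by an element of `Hom(V,W)^{⊗ n}`. -/
def powAct (n : ℕ) : (⨂[K]^n (V →ₗ[K] W)) →ₗ[K] (⨂[K]^n V) →ₗ[K] ⨂[K]^n W :=
  PiTensorProduct.piTensorHomMap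

lemma powAct_tprod (f : Fin n → V →ₗ[K] W) (x : Fin n → V) :
    powAct n (PiTensorProduct.tprod K f) (PiTensorProduct.tprod K x) =
      PiTensorProduct.tprod K (fun i => f i (x i)) :=
  PiTensorProduct.piTensorHomMap_tprod_tprod _ _

lemma permRep_powAct (σ : Equiv.Perm (Fin n)) (f : ⨂[K]^n (V →ₗ[K] W)) (x : ⨂[K]^n V) :
    permRep K n _ σ (powAct n f x) = powAct n (permRep K n _ σ f) (permRep K n _ σ x) := by
  induction f using ind with
  | h f =>
    induction x using ind with
    | h g => simp only [permRep_tprod, powAct_tprod]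
    | hs c x hx => simp only [map_smul, hx]
    | ha x y hx hy => simp only [map_add, hx, hy]
  | hs c x hx => simp only [map_smul, hx, LinearMap.smul_apply]
  | ha x y hx hy => simp only [map_add, hx, hy, LinearMap.add_apply]

lemma powAct_powComp (f : ⨂[K]^n (V →ₗ[K] W)) (g : ⨂[K]^n (U →ₗ[K] V)) :
    powAct n (powComp n f g) = powAct n f ∘ₗ powAct n g := by
  induction f using ind with
  | h f =>
    induction g using ind with
    | h g =>
      ext x
      simp only [LinearMap.compMultilinearMap_apply, LinearMap.comp_apply, powComp_tprod,
        powAct_tprod]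
    | hs c x hx => simp only [map_smul, hx, LinearMap.comp_smul]
    | ha x y hx hy => simp only [map_add, hx, hy, LinearMap.comp_add]
  | hs c x hx => simp only [map_smul, hx, LinearMap.smul_apply, LinearMap.smul_comp]
  | ha x y hx hy => simp only [map_add, hx, hy, LinearMap.add_apply, LinearMap.add_comp]

lemma powAct_id : powAct n (PiTensorProduct.tprod K (fun _ => (LinearMap.id : V →ₗ[K] V))) =
    LinearMap.id := by
  ext x
  simp only [LinearMap.compMultilinearMap_apply, powAct_tprod, LinearMap.id_apply]

/-! ### The comultiplication `Γ^{m+n}(X) → Γ^m(X) ⊗ Γ^n(X)` -/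

/-- Over a field, taking invariants commutes with tensoring with a vector space. -/
lemma mem_range_of_left {G : Type} [Group G] [Finite G] {A B : Type u} [AddCommGroup A] [Module K A]
    [AddCommGroup B] [Module K B] (ρ : Representation K G A) (x : A ⊗[K] B)
    (hx : ∀ g, (ρ g).rTensor B x = x) :
    x ∈ LinearMap.range (ρ.invariants.subtype.rTensor B) := by
  classical
  have := Fintype.ofFinite G
  let f : A →ₗ[K] (G → A) := LinearMap.pi fun g => ρ g - LinearMap.id
  have hex : Function.Exact ρ.invariants.subtype f := by
    intro a
    constructor
    · intro h
      refine ⟨⟨a, fun g => ?_⟩, rfl⟩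
      have := congrFun h g
      simpa [f, sub_eq_zero] using this
    · rintro ⟨⟨a, ha⟩, rfl⟩
      funext g
      simpa [f, sub_eq_zero] using ha g
  have hex2 := Module.Flat.rTensor_exact B hex
  refine (hex2 x).1 ?_
  refine (TensorProduct.piLeft K B (fun _ : G => A)).injective ?_
  rw [map_zero]
  funext g
  have key : ∀ y : A ⊗[K] B, TensorProduct.piLeft K B (fun _ : G => A) (f.rTensor B y) g =
      (ρ g).rTensor B y - y := by
    intro y
    induction y with
    | zero => simp
    | tmul a b => simp [f, TensorProduct.sub_tmul]
    | add y z hy hz => simp only [map_add, Pi.add_apply, hy, hz]; abel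
  rw [key, hx g, sub_self]; rfl

lemma mem_range_of_right {G : Type} [Group G] [Finite G] {A B : Type u} [AddCommGroup A]
    [Module K A] [AddCommGroup B] [Module K B] (ρ : Representation K G B) (x : A ⊗[K] B)
    (hx : ∀ g, (ρ g).lTensor A x = x) :
    x ∈ LinearMap.range (ρ.invariants.subtype.lTensor A) := by
  have h := mem_range_of_left ρ (TensorProduct.comm K A B x) (fun g => by
    rw [← LinearMap.comm_comp_lTensor_comp_comm_eq]
    simp [hx g])
  obtain ⟨y, hy⟩ := h
  refine ⟨TensorProduct.comm K _ _ y, ?_⟩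
  apply (TensorProduct.comm K A B).injective
  rw [← hy, ← LinearMap.comm_comp_lTensor_comp_comm_eq]
  rfl

lemma mem_range_of_both {G H : Type} [Group G] [Finite G] [Group H] [Finite H] {A B : Type u}
    [AddCommGroup A] [Module K A] [AddCommGroup B] [Module K B] (ρ : Representation K G A)
    (τ : Representation K H B) (x : A ⊗[K] B)
    (hx : ∀ g, (ρ g).rTensor B x = x) (hx' : ∀ h, (τ h).lTensor A x = x) :
    x ∈ LinearMap.range (TensorProduct.mapIncl ρ.invariants τ.invariants) := by
  obtain ⟨y, rfl⟩ := mem_range_of_left ρ x hx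
  have hinj : Function.Injective (ρ.invariants.subtype.rTensor B) :=
    Module.Flat.rTensor_preserves_injective_linearMap _ (Submodule.subtype_injective _)
  obtain ⟨z, rfl⟩ := mem_range_of_right τ y (fun h => hinj (by
    have := hx' h
    rw [← LinearMap.comp_apply, LinearMap.lTensor_comp_rTensor] at this
    rw [← LinearMap.comp_apply, LinearMap.rTensor_comp_lTensor]
    exact this))
  refine ⟨z, ?_⟩
  rw [← LinearMap.comp_apply, LinearMap.rTensor_comp_lTensor]

lemma mulEquiv_symm_tprod {m n : ℕ} (x : Fin (m + n) → X) :
    (TensorPower.mulEquiv (R := K) (M := X)).symm (PiTensorProduct.tprod K x) =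
      PiTensorProduct.tprod K (fun i => x (Fin.castAdd n i)) ⊗ₜ
        PiTensorProduct.tprod K (fun i => x (Fin.natAdd m i)) := by
  rw [LinearEquiv.symm_apply_eq]
  have := TensorPower.tprod_mul_tprod K (fun i => x (Fin.castAdd n i))
    (fun i => x (Fin.natAdd m i))
  rw [TensorPower.gMul_def] at this
  rw [this, Fin.append_castAdd_natAdd]

lemma mulEquiv_symm_perm {m n : ℕ} (σ : Equiv.Perm (Fin m)) (τ : Equiv.Perm (Fin n))
    (z : ⨂[K]^(m + n) X) :
    TensorPower.mulEquiv.symm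
      (permRep K (m + n) X (finSumFinEquiv.permCongr (Equiv.sumCongr σ τ)) z) =
    TensorProduct.map (permRep K m X σ) (permRep K n X τ) (TensorPower.mulEquiv.symm z) := by
  induction z using ind with
  | h x =>
    simp only [permRep_tprod, mulEquiv_symm_tprod, TensorProduct.map_tmul]
    congr 2
    · funext i
      simp [Equiv.permCongr, Equiv.equivCongr]
    · funext i
      simp [Equiv.permCongr, Equiv.equivCongr]
  | hs c x hx => simp only [map_smul, hx]
  | ha x y hx hy => simp only [map_add, hx, hy]

lemma mapIncl_injective (m n : ℕ) (X : Type u) [AddCommGroup X] [Module K X] :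
    Function.Injective (TensorProduct.mapIncl (DivPow K m X) (DivPow K n X)) :=
  TensorProduct.map_injective_of_flat_flat _ _ (Submodule.subtype_injective _)
    (Submodule.subtype_injective _)

lemma comul_aux (m n : ℕ) (z : DivPow K (m + n) X) :
    (TensorPower.mulEquiv (R := K) (M := X)).symm z.1 ∈
      LinearMap.range (TensorProduct.mapIncl (DivPow K m X) (DivPow K n X)) := by
  apply mem_range_of_both
  · intro g
    have := mulEquiv_symm_perm g 1 z.1
    rw [z.2, map_one] at this
    exact this.symm
  · intro h
    have := mulEquiv_symm_perm 1 h z.1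
    rw [z.2, map_one] at this
    exact this.symm

/-- The comultiplication `Γ^{m+n}(X) → Γ^m(X) ⊗ Γ^n(X)`: the restriction of the canonical
isomorphism `X^{⊗ (m+n)} ≅ X^{⊗ m} ⊗ X^{⊗ n}` to invariants. -/
def comul (m n : ℕ) (X : Type u) [AddCommGroup X] [Module K X] :
    DivPow K (m + n) X →ₗ[K] (DivPow K m X) ⊗[K] (DivPow K n X) :=
  (LinearEquiv.ofInjective _ (mapIncl_injective m n X)).symm.toLinearMap ∘ₗ
    LinearMap.codRestrict _
      ((TensorPower.mulEquiv (R := K) (M := X)).symm.toLinearMap ∘ₗ Submodule.subtype _)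
      (comul_aux m n)

lemma mapIncl_comul (m n : ℕ) (z : DivPow K (m + n) X) :
    TensorProduct.mapIncl (DivPow K m X) (DivPow K n X) (comul m n X z) =
      TensorPower.mulEquiv.symm z.1 := by
  have := LinearEquiv.apply_symm_apply
    (LinearEquiv.ofInjective _ (mapIncl_injective (K := K) m n X))
      ⟨TensorPower.mulEquiv.symm z.1, comul_aux m n z⟩
  exact congrArg Subtype.val this

lemma comul_divPow (m n : ℕ) (x : X) :
    comul m n X (divPow (K := K) (m + n) x) = divPow m x ⊗ₜ divPow n x := by
  apply mapIncl_injective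
  rw [mapIncl_comul]
  exact mulEquiv_symm_tprod _

lemma mulEquiv_symm_powComp {m n : ℕ} (f : ⨂[K]^(m + n) (V →ₗ[K] W))
    (g : ⨂[K]^(m + n) (U →ₗ[K] V)) :
    TensorPower.mulEquiv.symm (powComp (m + n) f g) =
      TensorProduct.map₂ (powComp m) (powComp n) (TensorPower.mulEquiv.symm f)
        (TensorPower.mulEquiv.symm g) := by
  induction f using ind with
  | h f =>
    induction g using ind with
    | h g => simp only [powComp_tprod, mulEquiv_symm_tprod, TensorProduct.map₂_apply_tmul,
        TensorProduct.map_tmul]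
    | hs c x hx => simp only [map_smul, hx]
    | ha x y hx hy => simp only [map_add, hx, hy]
  | hs c x hx => simp only [map_smul, hx, LinearMap.smul_apply]
  | ha x y hx hy => simp only [map_add, hx, hy, LinearMap.add_apply]

lemma comul_divComp (m n : ℕ) (f : DivPow K (m + n) (V →ₗ[K] W))
    (g : DivPow K (m + n) (U →ₗ[K] V)) :
    comul m n _ (divComp (m + n) f g) =
      TensorProduct.map₂ (divComp m) (divComp n) (comul m n _ f) (comul m n _ g) := by
  apply mapIncl_injective
  rw [mapIncl_comul, divComp_coe, mulEquiv_symm_powComp, ← mapIncl_comul, ← mapIncl_comul]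
  generalize comul m n _ f = a
  generalize comul m n _ g = b
  induction a with
  | zero => simp
  | tmul a a' =>
    induction b with
    | zero => simp
    | tmul b b' => rfl
    | add x y hx hy => simp only [map_add, hx, hy]
  | add x y hx hy => simp only [map_add, hx, hy, LinearMap.add_apply]

/-! ### Transposition and factorisation of the identity -/

/-- Transposition `Γⁿ(Hom(V,W)) → Γⁿ(Hom(W*,V*))`. -/
def divTranspose (n : ℕ) : DivPow K n (V →ₗ[K] W) →ₗ[K]
    DivPow K n (Module.Dual K W →ₗ[K] Module.Dual K V) :=
  divMap n Module.Dual.transpose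

lemma divTranspose_divPow (n : ℕ) (x : V →ₗ[K] W) :
    divTranspose n (divPow n x) = divPow n (Module.Dual.transpose x) :=
  Subtype.ext (PiTensorProduct.map_tprod _ _)

lemma divTranspose_divComp (n : ℕ) (f : DivPow K n (V →ₗ[K] W)) (g : DivPow K n (U →ₗ[K] V)) :
    divTranspose n (divComp n f g) = divComp n (divTranspose n g) (divTranspose n f) := by
  have key : ∀ (f : ⨂[K]^n (V →ₗ[K] W)) (g : ⨂[K]^n (U →ₗ[K] V)),
      PiTensorProduct.map (fun _ : Fin n => Module.Dual.transpose (R := K)) (powComp n f g) =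
      powComp n (PiTensorProduct.map (fun _ : Fin n => Module.Dual.transpose (R := K)) g)
        (PiTensorProduct.map (fun _ : Fin n => Module.Dual.transpose (R := K)) f) := by
    intro f g
    induction f using ind with
    | h f =>
      induction g using ind with
      | h g => simp only [powComp_tprod, PiTensorProduct.map_tprod]; rfl
      | hs c x hx => simp only [map_smul, hx, LinearMap.smul_apply]
      | ha x y hx hy => simp only [map_add, hx, hy, LinearMap.add_apply]
    | hs c x hx => simp only [map_smul, hx, LinearMap.smul_apply]
    | ha x y hx hy => simp only [map_add, hx, hy, LinearMap.add_apply]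
  exact Subtype.ext (key f.1 g.1)

/-- If `s` has more than `n` elements, `(∑_{i ∈ s} e i)^{⊗ n}` is a combination of the elements
`(∑_{i ∈ t} e i)^{⊗ n}` with `t` a proper subset of `s`. -/
lemma divPow_sum_mem {ι : Type} (n : ℕ) (e : ι → X) (s : Finset ι) (S : Submodule K (DivPow K n X))
    (hS : ∀ t : Finset ι, t.card ≤ n → divPow n (∑ i ∈ t, e i) ∈ S) :
    divPow n (∑ i ∈ s, e i) ∈ S := by
  classical
  induction s using Finset.strongInduction with
  | H s ih =>
    by_cases hs : s.card ≤ n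
    · exact hS s hs
    have hzero : ∑ t ∈ s.powerset, (-1 : K) ^ (s \ t).card •
        (divPow n (∑ i ∈ t, e i) : DivPow K n X) = 0 := by
      apply Subtype.ext
      have h1 : ∀ t ∈ s.powerset, PiTensorProduct.tprod K (fun _ : Fin n => ∑ i ∈ t, e i) =
          ∑ f ∈ Fintype.piFinset (fun _ : Fin n => s), if Finset.univ.image f ⊆ t then
            PiTensorProduct.tprod K (fun k => e (f k)) else 0 := by
        intro t ht
        rw [MultilinearMap.map_sum_finset, ← Finset.sum_filter]
        refine Finset.sum_congr ?_ fun _ _ => rfl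
        ext f
        simp only [Fintype.mem_piFinset, Finset.mem_filter, Finset.image_subset_iff,
          Finset.mem_univ, true_imp_iff]
        exact ⟨fun h => ⟨fun k => Finset.mem_powerset.1 ht (h k), h⟩, fun h => h.2⟩
      have h2 : ∀ f ∈ Fintype.piFinset (fun _ : Fin n => s),
          ∑ t ∈ s.powerset, (if Finset.univ.image f ⊆ t then (-1 : K) ^ (s \ t).card else 0) = 0 := by
        intro f hf
        rw [← Finset.sum_filter]
        have hne : (s \ Finset.univ.image f).Nonempty := by
          rw [Finset.sdiff_nonempty]
          intro h
          apply hs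
          calc s.card ≤ (Finset.univ.image f).card := Finset.card_le_card h
            _ ≤ (Finset.univ : Finset (Fin n)).card := Finset.card_image_le
            _ = n := by simp
        have h3 := Finset.sum_powerset_neg_one_pow_card_of_nonempty hne
        have hfs : Finset.univ.image f ⊆ s := by
          intro x hx
          obtain ⟨k, -, rfl⟩ := Finset.mem_image.1 hx
          exact Fintype.mem_piFinset.1 hf k
        have h4 : ∑ t ∈ s.powerset with Finset.univ.image f ⊆ t, (-1 : K) ^ (s \ t).card =
            ∑ r ∈ (s \ Finset.univ.image f).powerset, (-1 : K) ^ r.card := by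
          refine Finset.sum_nbij' (fun t => s \ t) (fun r => s \ r) ?_ ?_ ?_ ?_ ?_
          · intro t ht
            simp only [Finset.mem_filter, Finset.mem_powerset] at ht ⊢
            exact Finset.sdiff_subset_sdiff le_rfl ht.2
          · intro r hr
            simp only [Finset.mem_filter, Finset.mem_powerset] at hr ⊢
            refine ⟨Finset.sdiff_subset, fun x hx => Finset.mem_sdiff.2 ⟨hfs hx, fun hxr => ?_⟩⟩
            exact (Finset.mem_sdiff.1 (hr hxr)).2 hx
          · intro t ht
            simp only [Finset.mem_filter, Finset.mem_powerset] at ht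
            exact Finset.sdiff_sdiff_eq_self ht.1
          · intro r hr
            simp only [Finset.mem_powerset] at hr
            exact Finset.sdiff_sdiff_eq_self (hr.trans Finset.sdiff_subset)
          · intro t ht
            rfl
        rw [h4]
        have := congrArg (Int.cast : ℤ → K) h3
        simpa using this
      calc ((∑ t ∈ s.powerset, (-1 : K) ^ (s \ t).card •
            (divPow n (∑ i ∈ t, e i) : DivPow K n X) : DivPow K n X) : ⨂[K]^n X)
          = ∑ t ∈ s.powerset, (-1 : K) ^ (s \ t).card •
              PiTensorProduct.tprod K (fun _ : Fin n => ∑ i ∈ t, e i) := by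
            simp only [Submodule.coe_sum, Submodule.coe_smul]; rfl
        _ = ∑ t ∈ s.powerset, ∑ f ∈ Fintype.piFinset (fun _ : Fin n => s),
              (if Finset.univ.image f ⊆ t then (-1 : K) ^ (s \ t).card else 0) •
                PiTensorProduct.tprod K (fun k => e (f k)) := by
            refine Finset.sum_congr rfl fun t ht => ?_
            rw [h1 t ht, Finset.smul_sum]
            refine Finset.sum_congr rfl fun f _ => ?_
            split_ifs <;> simp
        _ = 0 := by
            rw [Finset.sum_comm]
            refine Finset.sum_eq_zero fun f hf => ?_
            rw [← Finset.sum_smul, h2 f hf, zero_smul]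
    rw [← Finset.sum_erase_add _ _ (Finset.mem_powerset_self s)] at hzero
    simp only [Finset.sdiff_self, Finset.card_empty, pow_zero, one_smul] at hzero
    rw [← neg_eq_of_add_eq_zero_right hzero]
    refine S.neg_mem (S.sum_mem fun t ht => S.smul_mem _ (ih t ?_))
    rw [Finset.mem_erase, Finset.mem_powerset] at ht
    exact ht.2.ssubset_of_ne ht.1


/-- In `Γⁿ(End V)` the identity is a combination of elements `γ(b) ∘ γ(a)` where `a : V → Kⁿ` and
`b : Kⁿ → V`. -/
lemma divPow_id_mem (n : ℕ) (V : Type u) [AddCommGroup V] [Module K V] [Module.Finite K V] :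
    divPow n (LinearMap.id : V →ₗ[K] V) ∈ Submodule.span K
      (Set.range fun p : ((Fin n → K) →ₗ[K] V) × (V →ₗ[K] (Fin n → K)) =>
        divComp n (divPow n p.1) (divPow n p.2)) := by
  classical
  let b := Module.finBasis K V
  let e : Fin (Module.finrank K V) → V →ₗ[K] V := fun i =>
    (b.coord i).smulRight (b i)
  have hid : (LinearMap.id : V →ₗ[K] V) = ∑ i ∈ Finset.univ, e i := by
    ext v
    simp [e, b.sum_repr]
  rw [hid]
  refine divPow_sum_mem n e _ _ fun t ht => Submodule.subset_span ?_
  let φ : t → Fin n := fun i => Fin.castLE ht (t.equivFin i)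
  have hφ : Function.Injective φ := fun i j h =>
    t.equivFin.injective (Fin.castLE_injective ht h)
  refine ⟨(∑ i : t, (LinearMap.proj (φ i)).smulRight (b i),
    ∑ i : t, (b.coord i).smulRight (Pi.single (φ i) 1)), ?_⟩
  have hc : (∑ i : t, ((LinearMap.proj (φ i)).smulRight (b i) : (Fin n → K) →ₗ[K] V)) ∘ₗ
      (∑ i : t, (b.coord i).smulRight (Pi.single (φ i) 1)) = ∑ i ∈ t, e i := by
    ext v
    rw [← Finset.sum_coe_sort t]
    simp [e, Pi.single_apply, hφ.eq_iff]
  refine Subtype.ext ?_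
  rw [divComp_coe, ← hc]
  exact powComp_tprod _ _

end Powers

/-! ### Linear functors with finite dimensional values -/

section LinearFunctors

variable (K : Type u) [Field K]

/-- The category of `K`-linear functors from a `K`-linear category `C` to finite dimensional vector
spaces. -/
abbrev LinFunctor (C : Type*) [Category* C] [Preadditive C] [Linear K C] :=
  ObjectProperty.FullSubcategory
    (fun F : C ⥤ FGModuleCat.{u} K => F.Additive ∧ F.Linear K)

variable {K}
variable {C D : Type*} [Category* C] [Preadditive C] [Linear K C]
  [Category* D] [Preadditive D] [Linear K D]

/-- A linear functor, built from its values and its action on morphisms by linear maps. -/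
def LinFunctor.ofLin (obj : C → FGModuleCat.{u} K)
    (map : ∀ {X Y : C}, (X ⟶ Y) → (obj X →ₗ[K] obj Y))
    (map_id : ∀ X : C, map (𝟙 X) = LinearMap.id)
    (map_comp : ∀ {X Y Z : C} (f : X ⟶ Y) (g : Y ⟶ Z), map (f ≫ g) = map g ∘ₗ map f)
    (map_add : ∀ {X Y : C} (f g : X ⟶ Y), map (f + g) = map f + map g)
    (map_smul : ∀ {X Y : C} (c : K) (f : X ⟶ Y), map (c • f) = c • map f) : LinFunctor K C :=
  ⟨{ obj := obj
     map := fun f => FGModuleCat.ofHom (map f)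
     map_id := fun X => FGModuleCat.hom_ext (map_id X)
     map_comp := fun f g => FGModuleCat.hom_ext (map_comp f g) },
   ⟨fun {_ _ f g} => FGModuleCat.hom_ext (map_add f g)⟩,
   ⟨fun f c => FGModuleCat.hom_ext (map_smul c f)⟩⟩

/-- A morphism of linear functors, built from linear maps. -/
def LinFunctor.homLin {F G : LinFunctor K C} (app : ∀ X : C, F.obj.obj X →ₗ[K] G.obj.obj X)
    (naturality : ∀ {X Y : C} (f : X ⟶ Y),
      app Y ∘ₗ (F.obj.map f).hom.hom = (G.obj.map f).hom.hom ∘ₗ app X) : F ⟶ G :=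
  ObjectProperty.homMk
    { app := fun X => FGModuleCat.ofHom (app X)
      naturality := fun _ _ f => FGModuleCat.hom_ext (naturality f) }

/-- The linear map `Hom(X,Y) → Hom(F X, F Y)` given by a linear functor `F`. -/
def LinFunctor.mapLin (F : LinFunctor K C) (X Y : C) :
    (X ⟶ Y) →ₗ[K] (F.obj.obj X →ₗ[K] F.obj.obj Y) where
  toFun f := (F.obj.map f).hom.hom
  map_add' f g := by
    have := F.property.1
    rw [F.obj.map_add]; rfl
  map_smul' c f := by
    have := F.property.1
    have := F.property.2
    rw [F.obj.map_smul]; rfl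

lemma LinFunctor.mapLin_id (F : LinFunctor K C) (X : C) :
    F.mapLin X X (𝟙 X) = LinearMap.id :=
  congrArg (fun φ : F.obj.obj X ⟶ F.obj.obj X => φ.hom.hom) (F.obj.map_id X)

lemma LinFunctor.mapLin_comp (F : LinFunctor K C) {X Y Z : C} (f : X ⟶ Y) (g : Y ⟶ Z) :
    F.mapLin X Z (f ≫ g) = F.mapLin Y Z g ∘ₗ F.mapLin X Y f :=
  congrArg (fun φ : F.obj.obj X ⟶ F.obj.obj Z => φ.hom.hom) (F.obj.map_comp f g)

lemma LinFunctor.hom_naturality {F G : LinFunctor K C} (α : F ⟶ G) {X Y : C} (f : X ⟶ Y) :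
    (α.hom.app Y).hom.hom ∘ₗ F.mapLin X Y f = G.mapLin X Y f ∘ₗ (α.hom.app X).hom.hom :=
  congrArg (fun φ : F.obj.obj X ⟶ G.obj.obj Y => φ.hom.hom) (α.hom.naturality f)

/-- Precomposition with a linear functor. -/
def precomp (i : C ⥤ D) [i.Additive] [i.Linear K] : LinFunctor K D ⥤ LinFunctor K C where
  obj F := ⟨i ⋙ F.obj, by
    have := F.property.1
    have := F.property.2
    exact ⟨inferInstance, inferInstance⟩⟩
  map α := ObjectProperty.homMk (Functor.whiskerLeft i α.hom)

/-- The duality `F ↦ (X ↦ F(δ X)*)` on linear functors, where `δ` is a contravariant linear functor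
from the source category to itself. -/
def dualFunctor (δ : Cᵒᵖ ⥤ C)
    (hadd : ∀ {X Y : C} (f g : X ⟶ Y), δ.map (f + g).op = δ.map f.op + δ.map g.op)
    (hsmul : ∀ {X Y : C} (c : K) (f : X ⟶ Y), δ.map (c • f).op = c • δ.map f.op) :
    (LinFunctor K C)ᵒᵖ ⥤ LinFunctor K C where
  obj F := LinFunctor.ofLin
    (fun X => FGModuleCat.of K (Module.Dual K (F.unop.obj.obj (δ.obj (Opposite.op X)))))
    (fun f => (F.unop.mapLin _ _ (δ.map f.op)).dualMap)
    (fun X => by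
      rw [op_id, δ.map_id, LinFunctor.mapLin_id]; exact LinearMap.dualMap_id)
    (fun f g => by
      rw [op_comp, δ.map_comp, LinFunctor.mapLin_comp]
      exact (LinearMap.dualMap_comp_dualMap _ _).symm)
    (fun f g => by rw [hadd, map_add]; exact map_add Module.Dual.transpose _ _)
    (fun c f => by rw [hsmul, map_smul]; exact map_smul Module.Dual.transpose _ _)
  map α := LinFunctor.homLin (fun X => (α.unop.hom.app (δ.obj (Opposite.op X))).hom.hom.dualMap)
    (fun f => by
      have h := LinFunctor.hom_naturality α.unop (δ.map f.op)
      exact congrArg LinearMap.dualMap h.symm)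
  map_id F := rfl
  map_comp α β := rfl

end LinearFunctors

/-! ### Functors on representations of a finite group -/

section Representations

variable (K : Type u) [Field K] (G : Type) [Group G]

/-- The category of `K`-linear functors from finite dimensional representations of `G` to finite
dimensional vector spaces. -/
abbrev RepFunctor := LinFunctor K (FDRep K G)

variable {K G}

/-- The action of `G` on a finite dimensional representation, as a `Representation`. -/
abbrev rep (M : FDRep K G) : Representation K G M := M.ρ

/-- The intertwining map underlying a morphism of representations. -/
def intertwining {M N : FDRep K G} (f : M ⟶ N) :
    Representation.IntertwiningMap (rep M) (rep N) where
  toLinearMap := f.hom.hom.hom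
  isIntertwining' g := by
    have h := f.comm g
    exact congrArg (fun φ : M.V ⟶ N.V => φ.hom.hom) h

/-- The functor `h_M = Hom_G(M, -)`. -/
def hObj (M : FDRep K G) : RepFunctor K G :=
  LinFunctor.ofLin (fun X => FGModuleCat.of K (M ⟶ X)) (fun f => Linear.rightComp K M f)
    (fun _ => LinearMap.ext fun h => Category.comp_id h)
    (fun f g => LinearMap.ext fun h => (Category.assoc h f g).symm)
    (fun f g => LinearMap.ext fun h => Preadditive.comp_add _ _ _ h f g)
    (fun c f => LinearMap.ext fun h => Linear.comp_smul _ _ _ h c f)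

/-- The assignment `M ↦ h_M` as a contravariant functor. -/
def hFunctor : (FDRep K G)ᵒᵖ ⥤ RepFunctor K G where
  obj M := hObj M.unop
  map {M N} φ := LinFunctor.homLin (fun X => Linear.leftComp K X φ.unop)
    (fun f => LinearMap.ext fun h => (Category.assoc φ.unop h f).symm)
  map_id M := by
    apply ObjectProperty.hom_ext
    ext X : 2
    exact FGModuleCat.hom_ext (LinearMap.ext fun h => Category.id_comp h)
  map_comp {M N P} φ ψ := by
    apply ObjectProperty.hom_ext
    ext X : 2
    exact FGModuleCat.hom_ext (LinearMap.ext fun h => Category.assoc ψ.unop φ.unop h)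

/-- The functor `t_M = M ⊗_G -`: the coinvariants of `M ⊗ X` under the diagonal action of `G`. -/
def tObj (M : FDRep K G) : RepFunctor K G :=
  LinFunctor.ofLin
    (fun X => FGModuleCat.of K (Representation.tprod (rep M) (rep X)).Coinvariants)
    (fun f => Representation.Coinvariants.map _ _
      (Representation.IntertwiningMap.lTensor (rep M) (intertwining f)))
    (fun X => by
      apply Representation.Coinvariants.hom_ext
      apply TensorProduct.ext'
      intro m x; rfl)
    (fun f g => by
      apply Representation.Coinvariants.hom_ext
      apply TensorProduct.ext'
      intro m x; rfl)
    (fun f g => by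
      apply Representation.Coinvariants.hom_ext
      apply TensorProduct.ext'
      intro m x
      exact congrArg (Representation.Coinvariants.mk _) (TensorProduct.tmul_add m _ _))
    (fun c f => by
      apply Representation.Coinvariants.hom_ext
      apply TensorProduct.ext'
      intro m x
      exact congrArg (Representation.Coinvariants.mk _) (TensorProduct.tmul_smul c m _))

/-- Restriction of an intertwining map to a subgroup. -/
def resIntertwining (H : Subgroup G) {M N : FDRep K G} (f : M ⟶ N) :
    Representation.IntertwiningMap ((rep M).comp H.subtype) ((rep N).comp H.subtype) where
  toLinearMap := f.hom.hom.hom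
  isIntertwining' g := (intertwining f).isIntertwining' g

/-- The functor `H₀(H, -)`, coinvariants under a subgroup `H` of `G`. -/
def H0lower (H : Subgroup G) : RepFunctor K G :=
  LinFunctor.ofLin
    (fun X => FGModuleCat.of K (Representation.Coinvariants ((rep X).comp H.subtype)))
    (fun f => Representation.Coinvariants.map _ _ (resIntertwining H f))
    (fun _ => Representation.Coinvariants.hom_ext rfl)
    (fun _ _ => Representation.Coinvariants.hom_ext rfl)
    (fun _ _ => Representation.Coinvariants.hom_ext rfl)
    (fun _ _ => Representation.Coinvariants.hom_ext rfl)

/-- The functor `H⁰(H, -)`, invariants under a subgroup `H` of `G`. -/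
def H0upper (H : Subgroup G) : RepFunctor K G :=
  LinFunctor.ofLin
    (fun X => FGModuleCat.of K (Representation.invariants ((rep X).comp H.subtype)))
    (fun f => f.hom.hom.hom.restrict fun x hx g => by
      have h := LinearMap.congr_fun ((resIntertwining H f).isIntertwining' g) x
      exact h.symm.trans (congrArg f.hom.hom.hom (hx g)))
    (fun _ => rfl) (fun _ _ => rfl) (fun _ _ => rfl) (fun _ _ => rfl)

/-- The permutation representation `K[G/H]`. -/
def permModule (K : Type u) [Field K] [Finite G] (H : Subgroup G) : FDRep K G :=
  FDRep.of (Representation.ofMulAction K G (G ⧸ H))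

/-- The contragredient representation, as a contravariant functor. -/
def dualRep : (FDRep K G)ᵒᵖ ⥤ FDRep K G where
  obj M := FDRep.of (Representation.dual (rep M.unop))
  map {M N} f :=
    { hom := FGModuleCat.ofHom (f.unop.hom.hom.hom.dualMap)
      comm := fun g => by
        apply FGModuleCat.hom_ext
        exact congrArg LinearMap.dualMap ((intertwining f.unop).isIntertwining' g⁻¹).symm }
  map_id M := rfl
  map_comp f g := rfl

/-- The duality `(𝔻 f)(M) = f(M*)*`. -/
def repDuality : (RepFunctor K G)ᵒᵖ ⥤ RepFunctor K G :=
  dualFunctor dualRep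
    (fun f g => by
      apply Action.Hom.ext
      apply FGModuleCat.hom_ext
      exact map_add Module.Dual.transpose _ _)
    (fun c f => by
      apply Action.Hom.ext
      apply FGModuleCat.hom_ext
      exact map_smul Module.Dual.transpose _ _)

end Representations

/-! ### Strict polynomial functors -/

section Strict

variable (K : Type u) [Field K]

/-- The category `ΓⁿV`: its objects are the finite dimensional vector spaces, and
`Hom(V,W) = Γⁿ(Hom_K(V,W))`. -/
structure GammaCat (n : ℕ) : Type (u + 1) where
  /-- the underlying finite dimensional vector space -/
  space : FGModuleCat.{u} K

variable {K} {n : ℕ}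

instance : Category.{u} (GammaCat K n) where
  Hom V W := DivPow K n (V.space →ₗ[K] W.space)
  id _ := divPow n LinearMap.id
  comp f g := divComp n g f
  id_comp f := Subtype.ext (powComp_id f.1)
  comp_id f := Subtype.ext (id_powComp f.1)
  assoc f g h := Subtype.ext (powComp_assoc h.1 g.1 f.1).symm

instance : Preadditive (GammaCat K n) where
  homGroup V W := inferInstanceAs (AddCommGroup (DivPow K n (V.space →ₗ[K] W.space)))
  add_comp _ _ _ f f' g := (divComp n g).map_add f f'
  comp_add _ _ _ f g g' := LinearMap.map_add₂ (divComp (K := K) n) g g' f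

instance : Linear K (GammaCat K n) where
  homModule V W := inferInstanceAs (Module K (DivPow K n (V.space →ₗ[K] W.space)))
  smul_comp _ _ _ c f g := (divComp n g).map_smul c f
  comp_smul _ _ _ f c g := LinearMap.map_smul₂ (divComp n) c g f

variable (K n)

/-- The category `𝒫ₙ` of homogeneous strict polynomial functors of degree `n`. -/
abbrev StrictPolyFunctor := LinFunctor K (GammaCat K n)

/-- The functor `i : ΓⁿV → Rep(𝔖ₙ)`, `V ↦ V^{⊗ n}`. -/
def tensorPowerFunctor : GammaCat K n ⥤ FDRep K (Equiv.Perm (Fin n)) where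
  obj V := FDRep.of (permRep K n V.space)
  map {V W} f :=
    { hom := FGModuleCat.ofHom (powAct n f.1)
      comm := fun σ => by
        apply FGModuleCat.hom_ext
        refine LinearMap.ext fun x => ?_
        have h := permRep_powAct σ f.1 x
        rw [f.2 σ] at h
        exact h.symm }
  map_id _ := by
    apply Action.Hom.ext
    apply FGModuleCat.hom_ext
    exact powAct_id
  map_comp f g := by
    apply Action.Hom.ext
    apply FGModuleCat.hom_ext
    exact powAct_powComp g.1 f.1

instance : (tensorPowerFunctor K n).Additive where
  map_add := by
    intro _ _ f g
    apply Action.Hom.ext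
    apply FGModuleCat.hom_ext
    exact map_add (powAct n) f.1 g.1

instance : (tensorPowerFunctor K n).Linear K where
  map_smul f c := by
    apply Action.Hom.ext
    apply FGModuleCat.hom_ext
    exact map_smul (powAct n) c f.1

/-- The functor `j^* : 𝒜ₙ → 𝒫ₙ`, precomposition with `V ↦ V^{⊗ n}`. -/
def jPull : RepFunctor K (Equiv.Perm (Fin n)) ⥤ StrictPolyFunctor K n :=
  precomp (tensorPowerFunctor K n)

/-- The functor `V ↦ V*` on `ΓⁿV`. -/
def dualGamma : (GammaCat K n)ᵒᵖ ⥤ GammaCat K n where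
  obj V := ⟨FGModuleCat.of K (Module.Dual K V.unop.space)⟩
  map f := divTranspose n f.unop
  map_id _ := divTranspose_divPow n LinearMap.id
  map_comp f g := divTranspose_divComp n f.unop g.unop

/-- The duality `(𝔻 F)(V) = F(V*)*` on strict polynomial functors. -/
def polyDuality : (StrictPolyFunctor K n)ᵒᵖ ⥤ StrictPolyFunctor K n :=
  dualFunctor (dualGamma K n) (fun f g => map_add (divTranspose n) f g)
    (fun c f => map_smul (divTranspose n) c f)

/-- The strict polynomial functor `Γⁿ`. -/
def dividedPower : StrictPolyFunctor K n := (jPull K n).obj (H0upper ⊤)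

/-- The strict polynomial functor `Sⁿ`. -/
def symmetricPower : StrictPolyFunctor K n := (jPull K n).obj (H0lower ⊤)

variable {K n}

/-- A morphism between strict polynomial functors is determined by its value on `Kⁿ`. -/
lemma hom_eq_zero {F G : StrictPolyFunctor K n} (α : F ⟶ G)
    (h : (α.hom.app ⟨FGModuleCat.of K (Fin n → K)⟩).hom.hom = 0) : α = 0 := by
  apply ObjectProperty.hom_ext
  ext V : 2
  apply FGModuleCat.hom_ext
  let Φ : (V ⟶ V) →ₗ[K] (F.obj.obj V →ₗ[K] G.obj.obj V) :=
    LinearMap.llcomp K _ _ _ (α.hom.app V).hom.hom ∘ₗ F.mapLin V V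
  have hΦ : ∀ x ∈ Submodule.span K (Set.range fun p : ((Fin n → K) →ₗ[K] V.space) ×
      (V.space →ₗ[K] (Fin n → K)) => divComp n (divPow n p.1) (divPow n p.2)), Φ x = 0 := by
    intro x hx
    induction hx using Submodule.span_induction with
    | mem x hx =>
      obtain ⟨p, rfl⟩ := hx
      let a : V ⟶ (⟨FGModuleCat.of K (Fin n → K)⟩ : GammaCat K n) := divPow n p.2
      let b : (⟨FGModuleCat.of K (Fin n → K)⟩ : GammaCat K n) ⟶ V := divPow n p.1
      change (α.hom.app V).hom.hom ∘ₗ F.mapLin V V (a ≫ b) = 0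
      rw [LinFunctor.mapLin_comp, ← LinearMap.comp_assoc, LinFunctor.hom_naturality, h]
      simp
    | zero => exact map_zero Φ
    | add x y _ _ hx hy => exact (map_add Φ x y).trans (by rw [hx, hy, add_zero])
    | smul c x _ hx => exact (map_smul Φ c x).trans (by rw [hx, smul_zero])
  have h1 := hΦ _ (divPow_id_mem n V.space)
  change (α.hom.app V).hom.hom ∘ₗ F.mapLin V V (𝟙 V) = 0 at h1
  rw [LinFunctor.mapLin_id] at h1
  exact h1

instance finite_hom (F G : StrictPolyFunctor K n) : Module.Finite K (F ⟶ G) := by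
  let E : (F ⟶ G) →ₗ[K] (F.obj.obj ⟨FGModuleCat.of K (Fin n → K)⟩ →ₗ[K]
      G.obj.obj ⟨FGModuleCat.of K (Fin n → K)⟩) :=
    { toFun := fun α => (α.hom.app ⟨FGModuleCat.of K (Fin n → K)⟩).hom.hom
      map_add' := fun _ _ => rfl
      map_smul' := fun _ _ => rfl }
  refine Module.Finite.of_injective E ?_
  rw [injective_iff_map_eq_zero]
  exact fun α h => hom_eq_zero α h

instance small_hom (F G : StrictPolyFunctor K n) : Small.{u} (F ⟶ G) :=
  Module.Finite.small K _

/-- The finite dimensional vector space `Hom_{𝒫ₙ}(F, G)`, moved to the universe of `K`. -/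
def homSpace (F G : StrictPolyFunctor K n) : FGModuleCat.{u} K :=
  FGModuleCat.of K (Shrink.{u} (F ⟶ G))

/-- The identification of `homSpace F G` with the space of morphisms. -/
def homSpaceEquiv (F G : StrictPolyFunctor K n) : homSpace F G ≃ₗ[K] (F ⟶ G) :=
  Shrink.linearEquiv K (F ⟶ G)

/-- Precomposition by `α : F' ⟶ F`, as a map `Hom(F, G) → Hom(F', G)`. -/
def homSpacePre {F F' : StrictPolyFunctor K n} (α : F' ⟶ F) (G : StrictPolyFunctor K n) :
    homSpace F G →ₗ[K] homSpace F' G :=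
  (homSpaceEquiv F' G).symm.toLinearMap ∘ₗ Linear.leftComp K G α ∘ₗ
    (homSpaceEquiv F G).toLinearMap

/-- Postcomposition by `β : G ⟶ G'`, as a map `Hom(F, G) → Hom(F, G')`. -/
def homSpacePost (F : StrictPolyFunctor K n) {G G' : StrictPolyFunctor K n} (β : G ⟶ G') :
    homSpace F G →ₗ[K] homSpace F G' :=
  (homSpaceEquiv F G').symm.toLinearMap ∘ₗ Linear.rightComp K F β ∘ₗ
    (homSpaceEquiv F G).toLinearMap

lemma homSpacePre_apply {F F' : StrictPolyFunctor K n} (α : F' ⟶ F) (G : StrictPolyFunctor K n)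
    (x : homSpace F G) :
    homSpaceEquiv F' G (homSpacePre α G x) = α ≫ homSpaceEquiv F G x :=
  LinearEquiv.apply_symm_apply _ _

lemma homSpacePost_apply (F : StrictPolyFunctor K n) {G G' : StrictPolyFunctor K n} (β : G ⟶ G')
    (x : homSpace F G) :
    homSpaceEquiv F G' (homSpacePost F β x) = homSpaceEquiv F G x ≫ β :=
  LinearEquiv.apply_symm_apply _ _

variable (K n) in
/-- The contravariant functor `M ↦ j^*(h_M)`. -/
def pullH : (FDRep K (Equiv.Perm (Fin n)))ᵒᵖ ⥤ StrictPolyFunctor K n := hFunctor ⋙ jPull K n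

lemma pullH_add {M N : FDRep K (Equiv.Perm (Fin n))} (f g : M ⟶ N) :
    (pullH K n).map (f + g).op = (pullH K n).map f.op + (pullH K n).map g.op := by
  apply ObjectProperty.hom_ext
  ext V : 2
  exact FGModuleCat.hom_ext (LinearMap.ext fun h => Preadditive.add_comp _ _ _ f g h)

lemma pullH_smul {M N : FDRep K (Equiv.Perm (Fin n))} (c : K) (f : M ⟶ N) :
    (pullH K n).map (c • f).op = c • (pullH K n).map f.op := by
  apply ObjectProperty.hom_ext
  ext V : 2
  exact FGModuleCat.hom_ext (LinearMap.ext fun h => Linear.smul_comp _ _ _ c f h)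

/-- The functor `j_*(F)(M) = Hom_{𝒫ₙ}(j^*(h_M), F)`. -/
def jPushObj (F : StrictPolyFunctor K n) : RepFunctor K (Equiv.Perm (Fin n)) :=
  LinFunctor.ofLin (fun M => homSpace ((pullH K n).obj (Opposite.op M)) F)
    (fun f => homSpacePre ((pullH K n).map f.op) F)
    (fun M => LinearMap.ext fun x => (homSpaceEquiv _ _).injective (by
      rw [homSpacePre_apply, op_id, CategoryTheory.Functor.map_id, Category.id_comp]; rfl))
    (fun f g => LinearMap.ext fun x => (homSpaceEquiv _ _).injective (by
      rw [LinearMap.comp_apply, homSpacePre_apply, homSpacePre_apply, homSpacePre_apply, op_comp,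
        Functor.map_comp, Category.assoc]))
    (fun f g => LinearMap.ext fun x => (homSpaceEquiv _ _).injective (by
      rw [LinearMap.add_apply, map_add, homSpacePre_apply, homSpacePre_apply, homSpacePre_apply,
        pullH_add, Preadditive.add_comp]))
    (fun c f => LinearMap.ext fun x => (homSpaceEquiv _ _).injective (by
      rw [LinearMap.smul_apply, map_smul, homSpacePre_apply, homSpacePre_apply,
        pullH_smul, Linear.smul_comp]))

variable (K n) in
/-- The functor `j_* : 𝒫ₙ → 𝒜ₙ`, `j_*(F)(M) = Hom_{𝒫ₙ}(j^*(h_M), F)`. -/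
def jPush : StrictPolyFunctor K n ⥤ RepFunctor K (Equiv.Perm (Fin n)) where
  obj F := jPushObj F
  map β := LinFunctor.homLin (fun M => homSpacePost _ β)
    (fun f => LinearMap.ext fun x => (homSpaceEquiv _ _).injective (by
      refine (homSpacePost_apply _ β _).trans (Eq.trans ?_ (homSpacePre_apply _ _ _).symm)
      refine (congrArg (fun y => y ≫ β) (homSpacePre_apply _ _ _)).trans ?_
      exact (Category.assoc _ _ _).trans
        (congrArg (fun y => (pullH K n).map f.op ≫ y) (homSpacePost_apply _ β x).symm)))
  map_id F := by
    apply ObjectProperty.hom_ext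
    ext M : 2
    refine FGModuleCat.hom_ext (LinearMap.ext fun x => (homSpaceEquiv _ _).injective ?_)
    exact (homSpacePost_apply _ _ _).trans (Category.comp_id _)
  map_comp β β' := by
    apply ObjectProperty.hom_ext
    ext M : 2
    refine FGModuleCat.hom_ext (LinearMap.ext fun x => (homSpaceEquiv _ _).injective ?_)
    refine (homSpacePost_apply _ _ _).trans (Eq.trans ?_ (homSpacePost_apply _ _ _).symm)
    refine Eq.trans ?_ (congrArg (fun y => y ≫ β') (homSpacePost_apply _ _ _)).symm
    exact (Category.assoc _ _ _).symm

variable (K n) in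
/-- The functor `j_! : 𝒫ₙ → 𝒜ₙ`, `j_!(F) = 𝔻(j_*(𝔻 F))`. -/
def jShriek : StrictPolyFunctor K n ⥤ RepFunctor K (Equiv.Perm (Fin n)) :=
  (polyDuality K n).rightOp ⋙ (jPush K n).op ⋙ repDuality

/-! ### Tensor products of strict polynomial functors -/

/-- The action of `Γ^{m+n}(Hom(V,W))` on `F(V) ⊗ G(V)`, through the comultiplication
`Γ^{m+n} → Γ^m ⊗ Γ^n`. -/
def tensorAct {m n : ℕ} (F : StrictPolyFunctor K m) (G : StrictPolyFunctor K n)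
    (V W : FGModuleCat.{u} K) : DivPow K (m + n) (V →ₗ[K] W) →ₗ[K]
      (F.obj.obj ⟨V⟩ ⊗[K] G.obj.obj ⟨V⟩ →ₗ[K] F.obj.obj ⟨W⟩ ⊗[K] G.obj.obj ⟨W⟩) :=
  TensorProduct.homTensorHomMap (RingHom.id K) _ _ _ _ ∘ₗ
    TensorProduct.map (F.mapLin ⟨V⟩ ⟨W⟩) (G.mapLin ⟨V⟩ ⟨W⟩) ∘ₗ comul m n (V →ₗ[K] W)

lemma tensorAct_id {m n : ℕ} (F : StrictPolyFunctor K m) (G : StrictPolyFunctor K n)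
    (V : FGModuleCat.{u} K) :
    tensorAct F G V V (divPow (m + n) LinearMap.id) = LinearMap.id := by
  rw [tensorAct, LinearMap.comp_apply, LinearMap.comp_apply, comul_divPow]
  have h1 := F.mapLin_id ⟨V⟩
  have h2 := G.mapLin_id ⟨V⟩
  refine Eq.trans (congrArg₂ TensorProduct.map h1 h2) ?_
  exact TensorProduct.map_id

lemma tensorAct_comp {m n : ℕ} (F : StrictPolyFunctor K m) (G : StrictPolyFunctor K n)
    (U V W : FGModuleCat.{u} K) (f : DivPow K (m + n) (V →ₗ[K] W))
    (g : DivPow K (m + n) (U →ₗ[K] V)) :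
    tensorAct F G U W (divComp (m + n) f g) = tensorAct F G V W f ∘ₗ tensorAct F G U V g := by
  simp only [tensorAct, LinearMap.comp_apply]
  rw [comul_divComp]
  generalize comul m n _ f = a
  generalize comul m n _ g = b
  induction a with
  | zero => simp
  | tmul a a' =>
    induction b with
    | zero => simp
    | tmul b b' =>
      have h1 := F.mapLin_comp (X := ⟨U⟩) (Y := ⟨V⟩) (Z := ⟨W⟩) b a
      have h2 := G.mapLin_comp (X := ⟨U⟩) (Y := ⟨V⟩) (Z := ⟨W⟩) b' a'
      refine Eq.trans (congrArg₂ TensorProduct.map h1 h2) ?_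
      exact TensorProduct.map_comp _ _ _ _
    | add x y hx hy => simp only [map_add, hx, hy, LinearMap.comp_add]
  | add x y hx hy => simp only [map_add, hx, hy, LinearMap.add_apply, LinearMap.add_comp]

/-- The tensor product `𝒫ₘ × 𝒫ₙ → 𝒫ₘ₊ₙ`, `(F ⊗ G)(V) = F(V) ⊗ G(V)`. -/
def polyTensor {m n : ℕ} (F : StrictPolyFunctor K m) (G : StrictPolyFunctor K n) :
    StrictPolyFunctor K (m + n) :=
  LinFunctor.ofLin (fun V => FGModuleCat.of K (F.obj.obj ⟨V.space⟩ ⊗[K] G.obj.obj ⟨V.space⟩))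
    (fun {V W} f => tensorAct F G V.space W.space f)
    (fun V => tensorAct_id F G V.space)
    (fun f g => tensorAct_comp F G _ _ _ g f)
    (fun f g => (tensorAct F G _ _).map_add f g)
    (fun c f => (tensorAct F G _ _).map_smul c f)

variable (K) in
/-- `S^{n₁} ⊗ ⋯ ⊗ S^{n_k}` for a list `(n₁, …, n_k)`; the empty tensor product is the constant
functor `S⁰ = K`. -/
def symmetricList : (l : List ℕ) → StrictPolyFunctor K l.sum
  | [] => symmetricPower K 0
  | a :: l => polyTensor (symmetricPower K a) (symmetricList l)

variable (K) in
/-- `Γ^{n₁} ⊗ ⋯ ⊗ Γ^{n_k}` for a list `(n₁, …, n_k)`; the empty tensor product is the constant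
functor `Γ⁰ = K`. -/
def dividedList : (l : List ℕ) → StrictPolyFunctor K l.sum
  | [] => dividedPower K 0
  | a :: l => polyTensor (dividedPower K a) (dividedList l)

/-- A partition `n₁ ≥ ⋯ ≥ n_k` of `n`, as a decreasing composition. -/
def partComp (lam : n.Partition) : Composition n where
  blocks := lam.parts.sort (· ≥ ·)
  blocks_pos h := lam.parts_pos ((Multiset.mem_sort _).1 h)
  blocks_sum := by
    rw [← Multiset.sum_coe, Multiset.sort_eq, lam.parts_sum]

variable (K) in
/-- The functor `S^λ = S^{n₁} ⊗ ⋯ ⊗ S^{n_k}`. -/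
def symmetricPart (lam : n.Partition) : StrictPolyFunctor K n :=
  (partComp lam).blocks_sum ▸ symmetricList K (partComp lam).blocks

variable (K) in
/-- The functor `Γ^λ = Γ^{n₁} ⊗ ⋯ ⊗ Γ^{n_k}`. -/
def dividedPart (lam : n.Partition) : StrictPolyFunctor K n :=
  (partComp lam).blocks_sum ▸ dividedList K (partComp lam).blocks

/-- The Young subgroup `𝔖_λ`, the permutations preserving each of the consecutive blocks of lengths
`n₁, …, n_k` of `{0, …, n - 1}`. -/
def youngSubgroup (lam : n.Partition) : Subgroup (Equiv.Perm (Fin n)) where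
  carrier := {σ | ∀ i, (partComp lam).index (σ i) = (partComp lam).index i}
  mul_mem' {σ τ} hσ hτ i := (hσ (τ i)).trans (hτ i)
  one_mem' _ := rfl
  inv_mem' {σ} hσ i := by
    have h := hσ (σ.symm i)
    rw [Equiv.apply_symm_apply] at h
    exact h.symm

variable (K) in
/-- The permutation representation `K[𝔖ₙ/𝔖_λ]`. -/
def youngModule (lam : n.Partition) : FDRep K (Equiv.Perm (Fin n)) :=
  permModule K (youngSubgroup lam)

end Strict

end StrictPoly

end

open StrictPoly

/-! Write `G` for the symmetric group and `i` for `V ↦ V^{⊗n}`. Two facts carry the argument.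

First, `i` is full (`tensorPowerFunctor_full`): for finite-dimensional spaces `Hom(V,W)^{⊗n}` is
`Hom(V^{⊗n}, W^{⊗n})`, and taking `G`-invariants on both sides gives all equivariant maps. Second,
`K[G/H]` with `H` a Young subgroup is a retract of some `i U` (`levelRetract`): it is the span of
the orbit of a basis tensor of `(K^κ)^{⊗n}` whose stabilizer is `H`.

The functor `T = H₀(H,-)` satisfies `T(X)* ≅ Hom(X, K[G/H])`, naturally in `X`
(`isDualRepresented_H0lower`). As all values are finite-dimensional, this gives a dual Yoneda lemma:
a transformation `F ⟶ T` is the same as a functional on `F(K[G/H])`. Since `K[G/H]` is a retract of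
`i U` and `i` is full, such a functional can be recovered from the restriction of the transformation
along `i`, so `Hom(F,T) ≅ Hom(j^*F, j^*T)` for every `F` (`IsDualRepresented.precompLin_bijective`).
For `F = h_M` the ordinary Yoneda lemma turns this into `T(M) ≅ Hom(j^*h_M, j^*T)`, that is `T ≅ j_*
j^* T`.

It remains to identify `S^λ` with `j^* H₀(𝔖_λ,-)` and `Γ^λ` with `j^* H⁰(𝔖_λ,-)`, by induction on
the list of parts, using that coinvariants and invariants of a product of groups on a tensor product
over a field factor. The statement on `j_!` follows by duality, from the perfect pairing of
`(V*)^{⊗n}` with `V^{⊗n}`. The description by `t` and `h` is Frobenius reciprocity.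

For the morphism spaces, `Hom(S^λ,S^μ)` is `Hom(H₀(𝔖_λ,-), H₀(𝔖_μ,-))` by the bijection above, and
dual representability makes this `Hom(K[G/𝔖_μ], K[G/𝔖_λ])`; transposing matrices in the coset bases
restores the direction. On the other side `Γ^λ ≅ j^* h_{K[G/𝔖_λ]}`, and fullness with the retraction
gives a contravariant Yoneda embedding (`pullHom_bijective`). -/

noncomputable section

namespace StrictPoly

/-! ### Fullness of `V ↦ V^{⊗n}`. -/

section PowAct

variable {K : Type u} [Field K] {n : ℕ} {V W : Type u} [AddCommGroup V] [Module K V]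
  [AddCommGroup W] [Module K W] [Module.Finite K V] [Module.Finite K W]

/-- Over a field, `Hom(V,W)^{⊗ n} → Hom(V^{⊗ n}, W^{⊗ n})` is bijective for finite dimensional
spaces. -/
lemma powAct_bijective : Function.Bijective (powAct (K := K) (V := V) (W := W) n) := by
  classical
  let b := Module.finBasis K V
  let c := Module.finBasis K W
  let B := Basis.piTensorProduct (fun _ : Fin n => b.linearMap c)
  let B' := (Basis.piTensorProduct (fun _ : Fin n => b)).linearMap
    (Basis.piTensorProduct (fun _ : Fin n => c))
  -- A tensor product of matrix units acts on `V^{⊗n}` as a single matrix unit, whose row and column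
  -- are the tuples of rows and columns. So `powAct` carries a basis to a basis.
  let E := B.equiv B' (Equiv.arrowProdEquivProdArrow (Fin n) _ _)
  have h : powAct (K := K) (V := V) (W := W) n = E.toLinearMap := by
    refine B.ext fun q => ?_
    refine (Basis.piTensorProduct (fun _ : Fin n => b)).ext fun v => ?_
    simp only [E, LinearEquiv.coe_coe, Module.Basis.equiv_apply]
    simp only [B, B']
    rw [Module.Basis.linearMap_apply_apply]
    simp only [Basis.piTensorProduct_apply, powAct_tprod, Module.Basis.linearMap_apply_apply]
    by_cases hv : v = fun i => (q i).2
    · subst hv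
      simp [Equiv.arrowProdEquivProdArrow]
    · obtain ⟨i, hi⟩ : ∃ i, v i ≠ (q i).2 := by
        by_contra! hcon
        exact hv (funext hcon)
      rw [if_neg (by simpa [Equiv.arrowProdEquivProdArrow, eq_comm] using hv)]
      exact (PiTensorProduct.tprod K).map_coord_zero i (by simp [hi.symm])
  rw [h]
  exact E.bijective

/-- An equivariant map is the action of a unique tensor `z`. Since `σ z` acts as the conjugate of
the action of `z` by `σ`, which is the same map, uniqueness makes `z` invariant. -/
instance tensorPowerFunctor_full : (tensorPowerFunctor K n).Full where
  map_surjective {V W} f := by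
    let φ := f.hom.hom.hom
    obtain ⟨z, hz⟩ := (powAct_bijective (K := K) (V := V.space) (W := W.space) (n := n)).2 φ
    refine ⟨⟨z, fun σ => powAct_bijective.1 ?_⟩, ?_⟩
    · refine LinearMap.ext fun x => ?_
      obtain ⟨y, rfl⟩ : ∃ y, permRep K n V.space σ y = x :=
        ⟨permRep K n V.space σ⁻¹ x, by
          rw [← Module.End.mul_apply, ← map_mul, mul_inv_cancel, map_one]; rfl⟩
      rw [← permRep_powAct, hz]
      exact (LinearMap.congr_fun ((intertwining f).isIntertwining' σ) y).symm
    · apply Action.Hom.ext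
      apply FGModuleCat.hom_ext
      exact hz

end PowAct

/-! ### Isomorphisms of linear functors. -/

section Iso

variable {K : Type u} [Field K] {C : Type*} [Category* C] [Preadditive C] [Linear K C]

/-- An isomorphism of linear functors, built from linear equivalences. -/
def LinFunctor.isoLin {F G : LinFunctor K C} (app : ∀ X : C, F.obj.obj X ≃ₗ[K] G.obj.obj X)
    (naturality : ∀ {X Y : C} (f : X ⟶ Y) (x : F.obj.obj X),
      app Y (F.mapLin X Y f x) = G.mapLin X Y f (app X x)) : F ≅ G where
  hom := LinFunctor.homLin (fun X => (app X).toLinearMap)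
    (fun f => LinearMap.ext fun x => naturality f x)
  inv := LinFunctor.homLin (fun X => (app X).symm.toLinearMap)
    (fun {X Y} f => LinearMap.ext fun x => (app Y).injective (by
      refine ((app Y).apply_symm_apply _).trans ?_
      refine Eq.trans ?_ (naturality f ((app X).symm x)).symm
      exact congrArg _ ((app X).apply_symm_apply x).symm))
  hom_inv_id := by
    apply ObjectProperty.hom_ext
    ext X : 2
    exact FGModuleCat.hom_ext (LinearMap.ext fun x => (app X).symm_apply_apply x)
  inv_hom_id := by
    apply ObjectProperty.hom_ext
    ext X : 2
    exact FGModuleCat.hom_ext (LinearMap.ext fun x => (app X).apply_symm_apply x)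

/-- The components of an isomorphism of linear functors. -/
def LinFunctor.isoApp {F G : LinFunctor K C} (e : F ≅ G) (X : C) :
    F.obj.obj X ≃ₗ[K] G.obj.obj X :=
  LinearEquiv.ofLinearMap (e.hom.hom.app X).hom.hom (e.inv.hom.app X).hom.hom
    (congrArg (fun φ : G ⟶ G => (φ.hom.app X).hom.hom) e.inv_hom_id)
    (congrArg (fun φ : F ⟶ F => (φ.hom.app X).hom.hom) e.hom_inv_id)

lemma LinFunctor.isoApp_naturality {F G : LinFunctor K C} (e : F ≅ G) {X Y : C} (f : X ⟶ Y)
    (x : F.obj.obj X) :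
    LinFunctor.isoApp e Y (F.mapLin X Y f x) = G.mapLin X Y f (LinFunctor.isoApp e X x) :=
  LinearMap.congr_fun (LinFunctor.hom_naturality e.hom f) x

lemma LinFunctor.hom_ext_lin {F G : LinFunctor K C} {α β : F ⟶ G}
    (h : ∀ (X : C) (x : F.obj.obj X), (α.hom.app X).hom.hom x = (β.hom.app X).hom.hom x) :
    α = β := by
  apply ObjectProperty.hom_ext
  ext X : 2
  exact FGModuleCat.hom_ext (LinearMap.ext fun x => h X x)

lemma LinFunctor.naturality_apply {F G : LinFunctor K C} (α : F ⟶ G) {X Y : C} (f : X ⟶ Y)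
    (x : F.obj.obj X) : (α.hom.app Y).hom.hom (F.mapLin X Y f x) =
      G.mapLin X Y f ((α.hom.app X).hom.hom x) :=
  LinearMap.congr_fun (LinFunctor.hom_naturality α f) x

lemma LinFunctor.mapLin_comp_apply (F : LinFunctor K C) {X Y Z : C} (f : X ⟶ Y) (g : Y ⟶ Z)
    (x : F.obj.obj X) : F.mapLin X Z (f ≫ g) x = F.mapLin Y Z g (F.mapLin X Y f x) :=
  LinearMap.congr_fun (F.mapLin_comp f g) x

lemma LinFunctor.mapLin_id_apply (F : LinFunctor K C) {X : C}
    (x : F.obj.obj X) : F.mapLin X X (𝟙 X) x = x :=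
  LinearMap.congr_fun (F.mapLin_id X) x

end Iso

/-! ### The dual Yoneda lemma and restriction along a full functor. -/

section DualRepresented

variable {K : Type u} [Field K] {A : Type*} [Category* A] [Preadditive A] [Linear K A]

/-- A linear functor `T` is dually represented by an object `N` and a functional `ev` on `T N` if
`g ↦ ev ∘ T g` identifies `Hom(X, N)` with the dual of `T X`, for all `X`. -/
def IsDualRepresented (T : LinFunctor K A) (N : A) (ev : T.obj.obj N →ₗ[K] K) : Prop :=
  ∀ X : A, Function.Bijective (fun g : X ⟶ N => ev ∘ₗ T.mapLin X N g)

variable {T : LinFunctor K A} {N : A} {ev : T.obj.obj N →ₗ[K] K}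

/-- The identification of `Hom(X, N)` with the dual of `T X`. -/
def IsDualRepresented.equivDual (h : IsDualRepresented T N ev) (X : A) :
    (X ⟶ N) ≃ₗ[K] Module.Dual K (T.obj.obj X) :=
  LinearEquiv.ofBijective (LinearMap.llcomp K _ _ _ ev ∘ₗ T.mapLin X N) (h X)

/-- The identification of `T X` with the dual of `Hom(X, N)`. -/
def IsDualRepresented.dualEquiv (h : IsDualRepresented T N ev) (X : A) :
    T.obj.obj X ≃ₗ[K] Module.Dual K (X ⟶ N) :=
  -- Finite dimension of `T X` enters here, through reflexivity.
  (Module.evalEquiv K (T.obj.obj X)).trans (h.equivDual X).dualMap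

lemma IsDualRepresented.dualEquiv_apply (h : IsDualRepresented T N ev) {X : A} (x : T.obj.obj X)
    (g : X ⟶ N) : h.dualEquiv X x g = ev (T.mapLin X N g x) := rfl

lemma IsDualRepresented.ext (h : IsDualRepresented T N ev) {X : A} {x y : T.obj.obj X}
    (hxy : ∀ g : X ⟶ N, ev (T.mapLin X N g x) = ev (T.mapLin X N g y)) : x = y :=
  (h.dualEquiv X).injective (LinearMap.ext hxy)

/-- The transformation `F ⟶ T` attached to a functional on `F N`. -/
def IsDualRepresented.desc (h : IsDualRepresented T N ev) (F : LinFunctor K A)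
    (ζ : F.obj.obj N →ₗ[K] K) : F ⟶ T :=
  LinFunctor.homLin
    -- The image of `x` is the element of `T X` whose functional on `Hom(X, N)` is `g ↦ ζ (F g x)`.
    (fun X => (h.dualEquiv X).symm.toLinearMap ∘ₗ
      (LinearMap.llcomp K _ _ _ ζ ∘ₗ F.mapLin X N).flip)
    (fun {X Y} f => LinearMap.ext fun x => (h.dualEquiv Y).injective (by
      refine LinearMap.ext fun g => ?_
      have h1 := h.dualEquiv_apply ((h.dualEquiv X).symm
        ((LinearMap.llcomp K _ _ _ ζ ∘ₗ F.mapLin X N).flip x)) (f ≫ g)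
      rw [LinearEquiv.apply_symm_apply, LinFunctor.mapLin_comp_apply] at h1
      refine Eq.trans ?_ h1
      refine (LinearMap.congr_fun ((h.dualEquiv Y).apply_symm_apply _) g).trans ?_
      exact congrArg ζ (LinFunctor.mapLin_comp_apply F f g x).symm))

/-- This formula pins down `desc`, because the functionals `ev ∘ T g` separate the points of `T X`.
Later arguments use only it and not the construction. -/
lemma IsDualRepresented.ev_desc (h : IsDualRepresented T N ev) (F : LinFunctor K A)
    (ζ : F.obj.obj N →ₗ[K] K) {X : A} (x : F.obj.obj X) (g : X ⟶ N) :
    ev (T.mapLin X N g (((h.desc F ζ).hom.app X).hom.hom x)) = ζ (F.mapLin X N g x) := by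
  rw [← h.dualEquiv_apply]
  exact LinearMap.congr_fun ((h.dualEquiv X).apply_symm_apply _) g

/-- The dual Yoneda lemma. -/
def IsDualRepresented.homEquiv (h : IsDualRepresented T N ev) (F : LinFunctor K A) :
    (F ⟶ T) ≃ₗ[K] Module.Dual K (F.obj.obj N) where
  toFun α := ev ∘ₗ (α.hom.app N).hom.hom
  map_add' _ _ := LinearMap.ext fun x => map_add ev _ _
  map_smul' _ _ := LinearMap.ext fun x => map_smul ev _ _
  invFun ζ := h.desc F ζ
  left_inv α := LinFunctor.hom_ext_lin fun X x => h.ext fun g => by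
    rw [h.ev_desc, ← LinFunctor.naturality_apply]; rfl
  right_inv ζ := LinearMap.ext fun x => by
    have h1 := h.ev_desc F ζ x (𝟙 N)
    rw [LinFunctor.mapLin_id_apply, LinFunctor.mapLin_id_apply] at h1
    exact h1

lemma IsDualRepresented.homEquiv_apply (h : IsDualRepresented T N ev) (F : LinFunctor K A)
    (α : F ⟶ T) (x : F.obj.obj N) : h.homEquiv F α x = ev ((α.hom.app N).hom.hom x) := rfl

variable {C : Type*} [Category* C] [Preadditive C] [Linear K C] (i : C ⥤ A) [i.Additive]
  [i.Linear K]

/-- Precomposition with `i`, as a linear map on transformations. -/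
def precompLin (F G : LinFunctor K A) :
    (F ⟶ G) →ₗ[K] ((precomp i).obj F ⟶ (precomp i).obj G) where
  toFun α := (precomp i).map α
  map_add' _ _ := rfl
  map_smul' _ _ := rfl

lemma precompLin_comp {F G H : LinFunctor K A} (α : F ⟶ G) (β : G ⟶ H) :
    precompLin i F H (α ≫ β) = precompLin i F G α ≫ precompLin i G H β := rfl


variable [i.Full]

/-- If the representing object of `T` is a retract of an object in the image of a full functor `i`,
then transformations into `T` are determined by their restriction along `i`, and all
transformations of the restrictions arise. -/
lemma IsDualRepresented.precompLin_bijective (h : IsDualRepresented T N ev) {U : C}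
    (r : Retract N (i.obj U)) (F : LinFunctor K A) :
    Function.Bijective (precompLin i F T) := by
  constructor
  · rw [injective_iff_map_eq_zero]
    intro α hα
    have hU : (α.hom.app (i.obj U)).hom.hom = 0 :=
      congrArg (fun β : (precomp i).obj F ⟶ (precomp i).obj T => (β.hom.app U).hom.hom) hα
    -- By the dual Yoneda lemma it suffices that `ev ∘ α_N` vanishes. Inserting `𝟙 N = r.i ≫ r.r`
    -- and using naturality replaces `α_N` by its component at `i.obj U`, which is zero.
    apply (h.homEquiv F).injective
    rw [map_zero]
    refine LinearMap.ext fun x => ?_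
    rw [h.homEquiv_apply, ← T.mapLin_id_apply ((α.hom.app N).hom.hom x), ← r.retract,
      T.mapLin_comp_apply, ← LinFunctor.naturality_apply, hU]
    simp
  · intro β
    -- The only possible choice: if `β` is the restriction of `α`, naturality along the retraction
    -- forces `ev ∘ α_N` to be this composite.
    let ζ : F.obj.obj N →ₗ[K] K :=
      ev ∘ₗ T.mapLin _ _ r.r ∘ₗ (β.hom.app U).hom.hom ∘ₗ F.mapLin _ _ r.i
    refine ⟨h.desc F ζ, LinFunctor.hom_ext_lin fun V (x : F.obj.obj (i.obj V)) => ?_⟩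
    let y : T.obj.obj (i.obj V) := (β.hom.app V).hom.hom x
    change ((h.desc F ζ).hom.app (i.obj V)).hom.hom x = y
    refine h.ext fun g => ?_
    -- `β` is natural only for morphisms coming from `C`. Fullness makes `g ≫ r.i`, a morphism
    -- between objects in the image of `i`, one of these.
    obtain ⟨f, hf⟩ := i.map_surjective (g ≫ r.i)
    have h1 : (β.hom.app U).hom.hom (F.mapLin _ _ (i.map f) x) = T.mapLin _ _ (i.map f) y :=
      LinFunctor.naturality_apply β f x
    have h2 : i.map f ≫ r.r = g := by rw [hf, Category.assoc, r.retract, Category.comp_id]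
    have h3 : F.mapLin _ _ r.i (F.mapLin (i.obj V) N g x) = F.mapLin _ _ (i.map f) x := by
      rw [hf, F.mapLin_comp_apply]
    have h4 : T.mapLin _ _ r.r (T.mapLin _ _ (i.map f) y) = T.mapLin (i.obj V) N g y := by
      rw [← h2, T.mapLin_comp_apply]
    refine (h.ev_desc F ζ x g).trans ?_
    rw [← h4, ← h1, ← h3]
    rfl

/-- Restriction along a full functor `i`, as a linear equivalence on transformations into a functor
dually represented by a retract of an object in the image of `i`. -/
def IsDualRepresented.precompEquiv (h : IsDualRepresented T N ev) {U : C}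
    (r : Retract N (i.obj U)) (F : LinFunctor K A) :
    (F ⟶ T) ≃ₗ[K] ((precomp i).obj F ⟶ (precomp i).obj T) :=
  LinearEquiv.ofBijective (precompLin i F T) (h.precompLin_bijective i r F)

/-- Restriction is functorial, hence so is its inverse wherever restriction is bijective. Only the
targets `T` and `T'` have to be dually represented; `F` is arbitrary. -/
lemma IsDualRepresented.precompEquiv_symm_comp {T' : LinFunctor K A} {N' : A}
    {ev' : T'.obj.obj N' →ₗ[K] K} (h : IsDualRepresented T N ev) (h' : IsDualRepresented T' N' ev')
    {U U' : C} (r : Retract N (i.obj U)) (r' : Retract N' (i.obj U')) {F : LinFunctor K A}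
    (α : (precomp i).obj F ⟶ (precomp i).obj T) (β : (precomp i).obj T ⟶ (precomp i).obj T') :
    (h'.precompEquiv i r' F).symm (α ≫ β) =
      (h.precompEquiv i r F).symm α ≫ (h'.precompEquiv i r' T).symm β := by
  rw [LinearEquiv.symm_apply_eq]
  refine Eq.trans ?_ (precompLin_comp i _ _).symm
  exact (congrArg₂ (· ≫ ·) ((h.precompEquiv i r F).apply_symm_apply α)
    ((h'.precompEquiv i r' T).apply_symm_apply β)).symm

end DualRepresented

/-! ### Yoneda lemmas: `j_* j^* T ≅ T` and full faithfulness of `M ↦ j^* h_M`. -/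

section Yoneda

variable {K : Type u} [Field K] {G : Type} [Group G]

/-- The Yoneda lemma for `h_M`. -/
def yonedaLin (M : FDRep K G) (F : RepFunctor K G) : F.obj.obj M ≃ₗ[K] (hObj M ⟶ F) where
  toFun x := LinFunctor.homLin (fun X => (F.mapLin M X).flip x) (fun {X Y} f =>
    LinearMap.ext fun g => F.mapLin_comp_apply g f x)
  map_add' x y := LinFunctor.hom_ext_lin fun X g => map_add (F.mapLin M X g) x y
  map_smul' c x := LinFunctor.hom_ext_lin fun X g => map_smul (F.mapLin M X g) c x
  invFun α := (α.hom.app M).hom.hom (𝟙 M)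
  left_inv x := F.mapLin_id_apply x
  right_inv α := LinFunctor.hom_ext_lin fun X g => by
    refine (LinFunctor.naturality_apply α g (𝟙 M)).symm.trans ?_
    exact congrArg _ (Category.id_comp g)

lemma yonedaLin_naturality {M M' : FDRep K G} (F : RepFunctor K G) (f : M ⟶ M')
    (x : F.obj.obj M) :
    yonedaLin M' F (F.mapLin M M' f x) = hFunctor.map f.op ≫ yonedaLin M F x :=
  LinFunctor.hom_ext_lin fun _ g => (F.mapLin_comp_apply f g x).symm

variable {n : ℕ}

/-- `j_* j^* T ≅ T` if `T` is dually represented by a retract of a tensor power. -/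
def IsDualRepresented.jPushIso {T : RepFunctor K (Equiv.Perm (Fin n))}
    {N : FDRep K (Equiv.Perm (Fin n))} {ev : T.obj.obj N →ₗ[K] K} (h : IsDualRepresented T N ev)
    {U : GammaCat K n} (r : Retract N ((tensorPowerFunctor K n).obj U)) :
    T ≅ (jPush K n).obj ((jPull K n).obj T) :=
  LinFunctor.isoLin
    -- `T(M) ≅ Hom(h_M, T) ≅ Hom(j^* h_M, j^* T)`, the second step being restriction along `V ↦
    -- V^{⊗n}`.
    (fun M => ((yonedaLin M T).trans (h.precompEquiv (tensorPowerFunctor K n) r (hObj M))).trans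
      (homSpaceEquiv ((pullH K n).obj (Opposite.op M)) ((jPull K n).obj T)).symm)
    (fun {M M'} f x => (homSpaceEquiv _ _).injective (by
      refine ((homSpaceEquiv _ _).apply_symm_apply _).trans ?_
      refine Eq.trans ?_ (homSpacePre_apply _ _ _).symm
      refine Eq.trans ?_ (congrArg (fun y => (pullH K n).map f.op ≫ y)
        ((homSpaceEquiv _ _).apply_symm_apply _).symm)
      exact congrArg ((jPull K n).map) (yonedaLin_naturality T f x)))

/-- The action of the contravariant functor `M ↦ j^* h_M` on morphisms, as a linear map. -/
def pullHom (M N : FDRep K (Equiv.Perm (Fin n))) :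
    (M ⟶ N) →ₗ[K] ((jPull K n).obj (hObj N) ⟶ (jPull K n).obj (hObj M)) where
  toFun f := (pullH K n).map f.op
  map_add' f g := pullH_add f g
  map_smul' c f := pullH_smul c f

lemma pullHom_comp {L M N : FDRep K (Equiv.Perm (Fin n))} (f : L ⟶ M) (g : M ⟶ N) :
    pullHom L N (f ≫ g) = pullHom M N g ≫ pullHom L M f := by
  change (pullH K n).map (f ≫ g).op = _
  rw [op_comp, Functor.map_comp]
  rfl

/-- The Yoneda argument with `r.i : N ⟶ U^{⊗n}` in the role of the identity of `N`, at which `j^*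
h_N` need not be evaluable. Every `f : N ⟶ V^{⊗n}` equals `r.i ≫ (r.r ≫ f)`, and `r.r ≫ f` comes
from `Γⁿ𝒱` by fullness, so a transformation is determined by its value on `r.i`. -/
lemma pullHom_bijective (M N : FDRep K (Equiv.Perm (Fin n))) {U : GammaCat K n}
    (r : Retract N ((tensorPowerFunctor K n).obj U)) :
    Function.Bijective (pullHom (K := K) (n := n) M N) := by
  constructor
  · rw [injective_iff_map_eq_zero]
    intro f hf
    have h1 : f ≫ r.i = 0 := congrArg
      (fun β : (jPull K n).obj (hObj N) ⟶ (jPull K n).obj (hObj M) =>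
        (β.hom.app U).hom.hom r.i) hf
    rw [← Category.comp_id f, ← r.retract, ← Category.assoc, h1, Limits.zero_comp]
  · intro β
    let g : M ⟶ (tensorPowerFunctor K n).obj U := (β.hom.app U).hom.hom r.i
    -- If `β` comes from `k : M ⟶ N`, then `g = k ≫ r.i`, so `k` must be `g ≫ r.r`.
    refine ⟨g ≫ r.r, LinFunctor.hom_ext_lin fun V (f : N ⟶ (tensorPowerFunctor K n).obj V) => ?_⟩
    obtain ⟨k, hk⟩ := (tensorPowerFunctor K n).map_surjective (r.r ≫ f)
    have h1 := LinFunctor.naturality_apply β k (r.i : N ⟶ (tensorPowerFunctor K n).obj U)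
    have h2 : r.i ≫ (tensorPowerFunctor K n).map k = f := by rw [hk, r.retract_assoc]
    have h3 : (β.hom.app V).hom.hom f = g ≫ (tensorPowerFunctor K n).map k :=
      (congrArg _ h2.symm).trans h1
    rw [h3, hk]
    exact (Category.assoc g r.r f).symm

end Yoneda

/-! ### Permutation modules and Frobenius reciprocity. -/

section PermModule

variable {K : Type u} [Field K] {G : Type} [Group G]

/-- A morphism of representations, built from an equivariant linear map. -/
def repHom {X Y : FDRep K G} (φ : X →ₗ[K] Y) (h : ∀ g x, φ (rep X g x) = rep Y g (φ x)) :
    X ⟶ Y where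
  hom := FGModuleCat.ofHom φ
  comm g := FGModuleCat.hom_ext (LinearMap.ext fun x => h g x)

lemma repHom_ext {X Y : FDRep K G} {f g : X ⟶ Y} (h : f.hom.hom.hom = g.hom.hom.hom) : f = g := by
  apply Action.Hom.ext
  exact FGModuleCat.hom_ext h

lemma rep_comm {X Y : FDRep K G} (f : X ⟶ Y) (g : G) (x : X) :
    f.hom.hom.hom (rep X g x) = rep Y g (f.hom.hom.hom x) :=
  LinearMap.congr_fun ((intertwining f).isIntertwining' g) x

lemma rep_mul (X : FDRep K G) (g h : G) (x : X) : rep X (g * h) x = rep X g (rep X h x) := by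
  rw [map_mul]; rfl

lemma rep_one (X : FDRep K G) (x : X) : rep X 1 x = x := by
  rw [map_one]; rfl

lemma rep_inv_rep (X : FDRep K G) (g : G) (x : X) : rep X g⁻¹ (rep X g x) = x := by
  rw [← rep_mul, inv_mul_cancel, rep_one]

variable (H : Subgroup G)

section

variable {H} {X : FDRep K G}

/-- The chosen representative of `gH` is `g h` with `h ∈ H`, and `h` fixes `x`. Formulas written
with `out` may thus be computed with any representative. -/
lemma rep_out_of_invariant {x : X} (hx : x ∈ Representation.invariants ((rep X).comp H.subtype))
    (g : G) : rep X (g : G ⧸ H).out x = rep X g x := by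
  obtain ⟨h, hh⟩ := QuotientGroup.mk_out_eq_mul H g
  rw [hh, rep_mul]
  exact congrArg _ (hx h)

lemma coinvariants_mk_rep (h : H) (x : X) :
    Representation.Coinvariants.mk ((rep X).comp H.subtype) (rep X h x) =
      Representation.Coinvariants.mk ((rep X).comp H.subtype) x :=
  (Representation.Coinvariants.mk_eq_iff _).2 (Representation.Coinvariants.sub_mem_ker h x)

/-- Here `(g h)⁻¹ = h⁻¹ g⁻¹`, and the outer factor `h⁻¹ ∈ H` disappears in the coinvariants. This is
why maps into `X_H` are indexed by cosets through inverses. -/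
lemma coinvariants_mk_out_inv (g : G) (x : X) :
    Representation.Coinvariants.mk ((rep X).comp H.subtype) (rep X (g : G ⧸ H).out⁻¹ x) =
      Representation.Coinvariants.mk ((rep X).comp H.subtype) (rep X g⁻¹ x) := by
  obtain ⟨h, hh⟩ := QuotientGroup.mk_out_eq_mul H g
  rw [hh, mul_inv_rev, rep_mul]
  exact coinvariants_mk_rep h⁻¹ _

lemma tprod_rep_apply (M X : FDRep K G) (g : G) (m : M) (x : X) :
    Representation.tprod (rep M) (rep X) g (m ⊗ₜ x) = rep M g m ⊗ₜ rep X g x := rfl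

end

variable [Finite G]

variable (K) in
/-- The basis `G/H` of the permutation representation. -/
def permBasis : Module.Basis (G ⧸ H) K (permModule K H) :=
  Module.Basis.ofRepr (MonoidAlgebra.coeffLinearEquiv K)

lemma rep_permBasis (g : G) (c : G ⧸ H) :
    rep (permModule K H) g (permBasis K H c) = permBasis K H (g • c) :=
  Representation.ofMulAction_single g c 1

variable {H} {X : FDRep K G}

/-- The morphism `K[G/H] ⟶ X` given by an `H`-invariant element of `X`. -/
def permLift (x : Representation.invariants ((rep X).comp H.subtype)) : permModule K H ⟶ X :=
  repHom ((permBasis K H).constr K fun c => rep X c.out x.1) (fun g y => by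
    let φ : permModule K H →ₗ[K] X := (permBasis K H).constr K fun c => rep X c.out x.1
    suffices h : φ ∘ₗ rep (permModule K H) g = rep X g ∘ₗ φ from LinearMap.congr_fun h y
    refine (permBasis K H).ext fun c => ?_
    obtain ⟨k, rfl⟩ := QuotientGroup.mk_surjective c
    rw [LinearMap.comp_apply, LinearMap.comp_apply, rep_permBasis]
    simp only [φ]
    rw [Module.Basis.constr_basis, Module.Basis.constr_basis, MulAction.Quotient.smul_mk,
      rep_out_of_invariant x.2,
      rep_out_of_invariant x.2, smul_eq_mul, rep_mul])

lemma permLift_permBasis (x : Representation.invariants ((rep X).comp H.subtype)) (g : G) :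
    (permLift x).hom.hom.hom (permBasis K H g) = rep X g x.1 := by
  refine ((permBasis K H).constr_basis K _ _).trans ?_
  exact rep_out_of_invariant x.2 g

/-- Frobenius reciprocity `X^H ≅ Hom(K[G/H], X)`. -/
def permLiftEquiv (X : FDRep K G) :
    Representation.invariants ((rep X).comp H.subtype) ≃ₗ[K] (permModule K H ⟶ X) where
  toFun := permLift
  map_add' x y := repHom_ext ((permBasis K H).ext fun c => by
    obtain ⟨k, rfl⟩ := QuotientGroup.mk_surjective c
    refine (permLift_permBasis _ _).trans ((map_add (rep X k) _ _).trans ?_)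
    exact (congrArg₂ (· + ·) (permLift_permBasis x k) (permLift_permBasis y k)).symm)
  map_smul' a x := repHom_ext ((permBasis K H).ext fun c => by
    obtain ⟨k, rfl⟩ := QuotientGroup.mk_surjective c
    refine (permLift_permBasis _ _).trans ((map_smul (rep X k) _ _).trans ?_)
    exact (congrArg (a • ·) (permLift_permBasis x k)).symm)
  invFun f := ⟨f.hom.hom.hom (permBasis K H (1 : G)), fun h => by
    refine (rep_comm f h.1 _).symm.trans ?_
    rw [rep_permBasis, MulAction.Quotient.smul_mk]
    congr 2
    exact QuotientGroup.eq.2 (by simp)⟩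
  left_inv x := Subtype.ext ((permLift_permBasis x 1).trans (rep_one _ _))
  right_inv f := repHom_ext ((permBasis K H).ext fun c => by
    obtain ⟨k, rfl⟩ := QuotientGroup.mk_surjective c
    refine (permLift_permBasis _ _).trans ?_
    refine (rep_comm f k _).symm.trans ?_
    rw [rep_permBasis, MulAction.Quotient.smul_mk, smul_eq_mul, mul_one])

variable (K H) in
/-- `H⁰(H, -) ≅ h_{K[G/H]}`. -/
def H0upperIso : (H0upper H : RepFunctor K G) ≅ hObj (permModule K H) :=
  LinFunctor.isoLin (fun X => permLiftEquiv X) (fun {X Y} f x =>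
    (permLiftEquiv Y).symm.injective (by
      refine ((permLiftEquiv Y).symm_apply_apply _).trans (Subtype.ext ?_)
      refine congrArg f.hom.hom.hom ?_
      exact ((permLift_permBasis x 1).trans (rep_one _ _)).symm))

lemma perm_tensor_ext {W : Type*} [AddCommGroup W] [Module K W]
    {φ ψ : permModule K H ⊗[K] X →ₗ[K] W}
    (h : ∀ (g : G) (x : X), φ (permBasis K H g ⊗ₜ x) = ψ (permBasis K H g ⊗ₜ x)) : φ = ψ := by
  apply TensorProduct.ext
  refine (permBasis K H).ext fun c => LinearMap.ext fun x => ?_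
  obtain ⟨k, rfl⟩ := QuotientGroup.mk_surjective c
  exact h k x

/-- `X_H ≅ (K[G/H] ⊗ X)_G`. -/
def coinvariantsPermEquiv (X : FDRep K G) :
    Representation.Coinvariants ((rep X).comp H.subtype) ≃ₗ[K]
      (Representation.tprod (rep (permModule K H)) (rep X)).Coinvariants :=
  -- The map is `x ↦ H ⊗ x`, with `H` the trivial coset; the inverse is `gH ⊗ x ↦ g⁻¹ x`.
  LinearEquiv.ofLinearMap
    (Representation.Coinvariants.lift _ (Representation.Coinvariants.mk _ ∘ₗ
        TensorProduct.mk K (permModule K H) X (permBasis K H (1 : G))) (fun h => by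
      refine LinearMap.ext fun x => ?_
      have h1 : permBasis K H (1 : G) = rep (permModule K H) h.1 (permBasis K H (1 : G)) := by
        rw [rep_permBasis, MulAction.Quotient.smul_mk]
        congr 1
        exact QuotientGroup.eq.2 (by simp)
      have h2 : (permBasis K H (1 : G) ⊗ₜ rep X h.1 x : permModule K H ⊗[K] X) =
          Representation.tprod (rep (permModule K H)) (rep X) h.1 (permBasis K H (1 : G) ⊗ₜ x) := by
        rw [tprod_rep_apply, ← h1]
      exact (congrArg (Representation.Coinvariants.mk _) h2).trans
        (Representation.Coinvariants.mk_self_apply _ h.1 _)))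
    (Representation.Coinvariants.lift _ (TensorProduct.lift ((permBasis K H).constr K fun c =>
        Representation.Coinvariants.mk _ ∘ₗ rep X c.out⁻¹)) (fun g => by
      refine perm_tensor_ext fun k x => ?_
      simp only [LinearMap.comp_apply,
        tprod_rep_apply, rep_permBasis, TensorProduct.lift.tmul, Module.Basis.constr_basis,
        MulAction.Quotient.smul_mk, smul_eq_mul, coinvariants_mk_out_inv]
      rw [← rep_mul, mul_inv_rev, mul_assoc, inv_mul_cancel, mul_one]))
    (by
      apply Representation.Coinvariants.hom_ext
      refine perm_tensor_ext fun k x => ?_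
      simp only [LinearMap.comp_apply,
        Representation.Coinvariants.lift_mk, TensorProduct.lift.tmul, Module.Basis.constr_basis,
        coinvariants_mk_out_inv, LinearMap.id_apply]
      -- Applying `k` to `H ⊗ k⁻¹ x` does not change its class and yields `kH ⊗ x`.
      rw [← Representation.Coinvariants.mk_self_apply _ k, TensorProduct.mk_apply, tprod_rep_apply,
        rep_permBasis,
        ← rep_mul, mul_inv_cancel, rep_one, MulAction.Quotient.smul_mk, smul_eq_mul, mul_one])
    (by
      apply Representation.Coinvariants.hom_ext
      refine LinearMap.ext fun x => ?_
      simp only [LinearMap.comp_apply,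
        Representation.Coinvariants.lift_mk, TensorProduct.lift.tmul, Module.Basis.constr_basis,
        coinvariants_mk_out_inv, LinearMap.id_apply, TensorProduct.mk_apply, inv_one, rep_one])

variable (K H) in
/-- `H₀(H, -) ≅ t_{K[G/H]}`. -/
def H0lowerIso : (H0lower H : RepFunctor K G) ≅ tObj (permModule K H) :=
  LinFunctor.isoLin (fun X => coinvariantsPermEquiv X) (fun {X Y} f x => by
    induction x using Representation.Coinvariants.induction_on with
    | h x => rfl)

end PermModule

/-! ### Dual representability of coinvariants by permutation modules. -/

section DualPerm

variable {K : Type u} [Field K] {G : Type} [Group G] [Finite G] {H : Subgroup G} {X : FDRep K G}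

/-- The group permutes the basis, so it permutes the coordinates by the inverse. With `g = k` the
coordinate at `kH` is moved to the one at the trivial coset. -/
lemma coord_rep_permModule (g k : G) (y : permModule K H) :
    (permBasis K H).coord (k : G ⧸ H) (rep (permModule K H) g y) =
      (permBasis K H).coord ((g⁻¹ * k : G) : G ⧸ H) y := by
  classical
  suffices h : (permBasis K H).coord (k : G ⧸ H) ∘ₗ rep (permModule K H) g =
      (permBasis K H).coord ((g⁻¹ * k : G) : G ⧸ H) from LinearMap.congr_fun h y
  refine (permBasis K H).ext fun c => ?_
  rw [LinearMap.comp_apply, rep_permBasis, Module.Basis.coord_apply, Module.Basis.coord_apply,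
    Module.Basis.repr_self_apply, Module.Basis.repr_self_apply]
  congr 1
  rw [← smul_eq_mul, ← MulAction.Quotient.smul_mk, eq_inv_smul_iff]

variable (K H) in
/-- The coefficient of the trivial coset, as a functional on `K[G/H]_H`. -/
def permEv : (H0lower H : RepFunctor K G).obj.obj (permModule K H) →ₗ[K] K :=
  Representation.Coinvariants.lift _ ((permBasis K H).coord (1 : G)) (fun h => by
    refine LinearMap.ext fun y => ?_
    refine (coord_rep_permModule h.1 1 y).trans ?_
    congr 2
    exact QuotientGroup.eq.2 (by simp))

/-- The linear map `X → K[G/H]` given by a functional on `X_H`. -/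
def permColiftLin (ζ : Representation.Coinvariants ((rep X).comp H.subtype) →ₗ[K] K) :
    X →ₗ[K] permModule K H :=
  letI := Fintype.ofFinite (G ⧸ H)
  -- This is `x ↦ ∑ ζ[g⁻¹ x] · gH` over the cosets. Equivariance forces it, once the coefficient at
  -- the trivial coset is `ζ[x]`.
  (permBasis K H).equivFun.symm.toLinearMap ∘ₗ
    LinearMap.pi fun c => ζ ∘ₗ Representation.Coinvariants.mk _ ∘ₗ rep X c.out⁻¹

lemma coord_permColiftLin (ζ : Representation.Coinvariants ((rep X).comp H.subtype) →ₗ[K] K)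
    (g : G) (x : X) : (permBasis K H).coord (g : G ⧸ H) (permColiftLin ζ x) =
      ζ (Representation.Coinvariants.mk _ (rep X g⁻¹ x)) := by
  let _ := Fintype.ofFinite (G ⧸ H)
  have h1 : (permBasis K H).equivFun (permColiftLin ζ x) = fun c : G ⧸ H =>
      ζ (Representation.Coinvariants.mk _ (rep X c.out⁻¹ x)) :=
    (permBasis K H).equivFun.apply_symm_apply _
  refine (congrFun h1 g).trans ?_
  rw [coinvariants_mk_out_inv]

lemma permModule_ext {y z : permModule K H}
    (h : ∀ g : G, (permBasis K H).coord (g : G ⧸ H) y = (permBasis K H).coord (g : G ⧸ H) z) :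
    y = z := by
  refine (permBasis K H).ext_elem fun c => ?_
  obtain ⟨k, rfl⟩ := QuotientGroup.mk_surjective c
  exact h k

/-- The morphism `X ⟶ K[G/H]` given by a functional on `X_H`. -/
def permColift (ζ : Representation.Coinvariants ((rep X).comp H.subtype) →ₗ[K] K) :
    X ⟶ permModule K H :=
  repHom (permColiftLin ζ) (fun g x => permModule_ext fun k => by
    rw [coord_permColiftLin, coord_rep_permModule, coord_permColiftLin, ← rep_mul, mul_inv_rev,
      inv_inv])

variable (K H) in
/-- `H₀(H, -)` is dually represented by `K[G/H]`. -/
lemma isDualRepresented_H0lower :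
    IsDualRepresented (H0lower H : RepFunctor K G) (permModule K H) (permEv K H) := by
  intro X
  have key : ∀ (f : X ⟶ permModule K H) (x : X),
      (permEv K H ∘ₗ (H0lower H).mapLin X (permModule K H) f)
        (Representation.Coinvariants.mk _ x) =
      (permBasis K H).coord ((1 : G) : G ⧸ H) (f.hom.hom.hom x) := fun f x => rfl
  constructor
  -- An equivariant map into `K[G/H]` is determined by its coefficient at the trivial coset: the
  -- coefficient of `f x` at `kH` is that of `f (k⁻¹ x)` at `H`.
  · intro f g hfg
    refine repHom_ext (LinearMap.ext fun x => permModule_ext fun k => ?_)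
    have h1 := LinearMap.congr_fun hfg (Representation.Coinvariants.mk _ (rep X k⁻¹ x))
    refine Eq.trans ?_ (((key f _).symm.trans (h1.trans (key g _))).trans ?_)
    · rw [rep_comm, coord_rep_permModule, inv_inv, mul_one]
    · rw [rep_comm, coord_rep_permModule, inv_inv, mul_one]
  · intro ζ
    refine ⟨permColift ζ, Representation.Coinvariants.hom_ext (LinearMap.ext fun x => ?_)⟩
    refine (key (permColift ζ) x).trans ((coord_permColiftLin ζ 1 x).trans ?_)
    rw [inv_one, rep_one]
    rfl

/-- `K[G/H]` is a retract of `X` if there are an `H`-invariant element `x` and an `H`-invariant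
functional `ζ` with `ζ (g x) = 1` for `g ∈ H` and `ζ (g x) = 0` otherwise. -/
def permRetract (x : Representation.invariants ((rep X).comp H.subtype))
    (ζ : Representation.Coinvariants ((rep X).comp H.subtype) →ₗ[K] K)
    (h1 : ∀ g ∈ H, ζ (Representation.Coinvariants.mk _ (rep X g x.1)) = 1)
    (h0 : ∀ g ∉ H, ζ (Representation.Coinvariants.mk _ (rep X g x.1)) = 0) :
    Retract (permModule K H) X where
  i := permLift x
  r := permColift ζ
  retract := repHom_ext ((permBasis K H).ext fun c => permModule_ext fun k => by
    classical
    obtain ⟨l, rfl⟩ := QuotientGroup.mk_surjective c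
    have h2 : (permLift x ≫ permColift ζ).hom.hom.hom (permBasis K H l) =
        permColiftLin ζ (rep X l x.1) := congrArg (permColiftLin ζ) (permLift_permBasis x l)
    refine (congrArg _ h2).trans ((coord_permColiftLin ζ k _).trans ?_)
    refine Eq.trans ?_ ((permBasis K H).repr_self_apply l k).symm
    -- The coefficient at `kH` of the image of `lH` is `ζ[k⁻¹ l x]`, which is one or zero according
    -- to whether `k⁻¹ l` lies in `H`.
    rw [← rep_mul]
    split_ifs with h
    · exact h1 _ (QuotientGroup.eq.1 h.symm)
    · exact h0 _ fun hh => h (QuotientGroup.eq.2 hh).symm)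

/-! ### Transposition of maps between permutation modules. -/

section Transpose

variable (H) (H' H'' : Subgroup G)

/-- The transpose of a linear map between permutation modules. -/
def permTransposeLin : (permModule K H →ₗ[K] permModule K H') ≃ₗ[K]
    (permModule K H' →ₗ[K] permModule K H) :=
  letI := Classical.decEq (G ⧸ H)
  letI := Classical.decEq (G ⧸ H')
  letI := Fintype.ofFinite (G ⧸ H)
  letI := Fintype.ofFinite (G ⧸ H')
  (LinearMap.toMatrix (permBasis K H) (permBasis K H')).trans
    ((Matrix.transposeLinearEquiv _ _ K K).trans (Matrix.toLin (permBasis K H') (permBasis K H)))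

variable {H H' H''}

lemma coord_permTransposeLin (φ : permModule K H →ₗ[K] permModule K H') (c : G ⧸ H) (d : G ⧸ H') :
    (permBasis K H).coord c (permTransposeLin H H' φ (permBasis K H' d)) =
      (permBasis K H').coord d (φ (permBasis K H c)) := by
  let _ := Classical.decEq (G ⧸ H)
  let _ := Classical.decEq (G ⧸ H')
  let _ := Fintype.ofFinite (G ⧸ H)
  let _ := Fintype.ofFinite (G ⧸ H')
  have h := LinearMap.toMatrix_apply (permBasis K H') (permBasis K H) (permTransposeLin H H' φ) c d
  refine h.symm.trans ?_
  have h2 : LinearMap.toMatrix (permBasis K H') (permBasis K H) (permTransposeLin H H' φ) =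
      (LinearMap.toMatrix (permBasis K H) (permBasis K H') φ).transpose := by
    rw [← LinearMap.toMatrix_toLin (permBasis K H') (permBasis K H)
      (LinearMap.toMatrix (permBasis K H) (permBasis K H') φ).transpose]
    rfl
  rw [h2, Matrix.transpose_apply, LinearMap.toMatrix_apply]
  rfl

lemma permLin_ext {φ ψ : permModule K H →ₗ[K] permModule K H'}
    (h : ∀ c d, (permBasis K H').coord d (φ (permBasis K H c)) =
      (permBasis K H').coord d (ψ (permBasis K H c))) : φ = ψ :=
  (permBasis K H).ext fun c => (permBasis K H').ext_elem fun d => h c d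

lemma permTransposeLin_permTransposeLin (φ : permModule K H →ₗ[K] permModule K H') :
    permTransposeLin H' H (permTransposeLin H H' φ) = φ :=
  permLin_ext fun c d => by rw [coord_permTransposeLin, coord_permTransposeLin]

lemma permTransposeLin_comp (φ : permModule K H →ₗ[K] permModule K H')
    (ψ : permModule K H' →ₗ[K] permModule K H'') :
    permTransposeLin H H'' (ψ ∘ₗ φ) = permTransposeLin H H' φ ∘ₗ permTransposeLin H' H'' ψ := by
  classical
  let _ := Fintype.ofFinite (G ⧸ H)
  let _ := Fintype.ofFinite (G ⧸ H')
  let _ := Fintype.ofFinite (G ⧸ H'')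
  refine permLin_ext fun d c => ?_
  rw [coord_permTransposeLin, LinearMap.comp_apply, LinearMap.comp_apply,
    ← (permBasis K H').sum_repr (φ (permBasis K H c)),
    ← (permBasis K H').sum_repr (permTransposeLin H' H'' ψ _)]
  simp only [map_sum, map_smul, coord_permTransposeLin, ← Module.Basis.coord_apply, smul_eq_mul]
  exact Finset.sum_congr rfl fun _ _ => mul_comm _ _

/-- Permutation matrices are orthogonal. Therefore the transpose of an equivariant map is again
equivariant. -/
lemma permTransposeLin_rep (g : G) :
    permTransposeLin H H (rep (permModule K H) g) = rep (permModule K H) g⁻¹ := by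
  classical
  refine permLin_ext fun d c => ?_
  rw [coord_permTransposeLin, rep_permBasis, rep_permBasis]
  simp only [Module.Basis.coord_apply, Module.Basis.repr_self_apply]
  congr 1
  rw [inv_smul_eq_iff]
  exact propext eq_comm

/-- The transpose of a morphism between permutation modules. -/
def permTranspose (f : permModule K H ⟶ permModule K H') : permModule K H' ⟶ permModule K H :=
  repHom (permTransposeLin H H' f.hom.hom.hom) (fun g x => by
    have h1 : f.hom.hom.hom ∘ₗ rep (permModule K H) g⁻¹ =
      rep (permModule K H') g⁻¹ ∘ₗ f.hom.hom.hom := LinearMap.ext fun y => rep_comm f g⁻¹ y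
    have h2 := congrArg (permTransposeLin H H') h1
    rw [permTransposeLin_comp, permTransposeLin_comp, permTransposeLin_rep, permTransposeLin_rep,
      inv_inv] at h2
    exact (LinearMap.congr_fun h2 x).symm)

variable (K H H') in
/-- Transposition, as a linear equivalence. -/
def permTransposeEquiv : (permModule K H ⟶ permModule K H') ≃ₗ[K]
    (permModule K H' ⟶ permModule K H) where
  toFun := permTranspose
  map_add' _ _ := repHom_ext (map_add (permTransposeLin H H') _ _)
  map_smul' _ _ := repHom_ext (map_smul (permTransposeLin H H') _ _)
  invFun := permTranspose
  left_inv _ := repHom_ext (permTransposeLin_permTransposeLin _)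
  right_inv _ := repHom_ext (permTransposeLin_permTransposeLin _)

lemma permTransposeEquiv_comp (f : permModule K H ⟶ permModule K H')
    (g : permModule K H' ⟶ permModule K H'') :
    permTransposeEquiv K H H'' (f ≫ g) =
      permTransposeEquiv K H' H'' g ≫ permTransposeEquiv K H H' f :=
  repHom_ext (permTransposeLin_comp _ _)

end Transpose

/-! ### Transformations between functors of coinvariants. -/

section HomH0lower

variable (K) (H H' H'' : Subgroup G)

/-- `Hom(H₀(H, -), H₀(H', -)) ≅ Hom(K[G/H], K[G/H'])`. -/
def homH0lowerEquiv : ((H0lower H : RepFunctor K G) ⟶ H0lower H') ≃ₗ[K]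
    (permModule K H ⟶ permModule K H') :=
  -- With `T = H₀(H,-)`, the chain is `Hom(T, H₀(H',-)) ≅ T(K[G/H'])* ≅ Hom(K[G/H'], K[G/H])`. This
  -- is contravariant, and the transpose corrects the direction.
  (((isDualRepresented_H0lower K H').homEquiv (H0lower H)).trans
    ((isDualRepresented_H0lower K H).equivDual (permModule K H')).symm).trans
      (permTransposeEquiv K H' H)

variable {K H H' H''}

/-- Before transposition `α` corresponds to the unique `f : K[G/H'] ⟶ K[G/H]` with `ev ∘ H₀(H, f) =
ev' ∘ α`, where `ev` and `ev'` are the functionals `permEv` of `H` and `H'`; this is `key`. By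
naturality the property passes to composites with the order reversed, and the transpose reverses it
back. -/
lemma homH0lowerEquiv_comp (α : (H0lower H : RepFunctor K G) ⟶ H0lower H')
    (β : (H0lower H' : RepFunctor K G) ⟶ H0lower H'') :
    homH0lowerEquiv K H H'' (α ≫ β) = homH0lowerEquiv K H H' α ≫ homH0lowerEquiv K H' H'' β := by
  have key : ∀ {H H' : Subgroup G} (α : (H0lower H : RepFunctor K G) ⟶ H0lower H')
      (x : (H0lower H : RepFunctor K G).obj.obj (permModule K H')),
      permEv K H ((H0lower H).mapLin _ _ (((isDualRepresented_H0lower K H).equivDual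
        (permModule K H')).symm ((isDualRepresented_H0lower K H').homEquiv (H0lower H) α)) x) =
      permEv K H' ((α.hom.app _).hom.hom x) := fun {H H'} α x => LinearMap.congr_fun
    (((isDualRepresented_H0lower K H).equivDual (permModule K H')).apply_symm_apply _) x
  simp only [homH0lowerEquiv, LinearEquiv.trans_apply]
  rw [← permTransposeEquiv_comp]
  congr 1
  rw [LinearEquiv.symm_apply_eq]
  refine LinearMap.ext fun x => ?_
  refine Eq.trans ?_ (congrArg (permEv K H) (LinFunctor.mapLin_comp_apply _ _ _ x)).symm
  rw [key, LinFunctor.naturality_apply, key]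
  rfl

end HomH0lower

end DualPerm

/-! ### Permutation modules as retracts of tensor powers. -/

section LevelRetract

variable (K : Type u) [Field K] {n : ℕ} {κ : Type} [Fintype κ]

/-- The permutation representation on the cosets of the stabilizer of a map `w : Fin n → κ` is a
retract of `(K^κ)^{⊗ n}`. -/
def levelRetract (w : Fin n → κ) (H : Subgroup (Equiv.Perm (Fin n)))
    (hH : ∀ σ, σ ∈ H ↔ ∀ i, w (σ i) = w i) :
    Retract (permModule K H)
      ((tensorPowerFunctor K n).obj ⟨FGModuleCat.of K (κ → K)⟩) :=
  letI := Classical.decEq κ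
  -- `φ` is the coordinate at the basis tensor `e_w = ⊗ e_{w i}`. As `σ e_w = e_{w ∘ σ⁻¹}`, the
  -- stabilizer of `e_w` is `H`, and `φ` is one on `e_w` and zero on the rest of its orbit.
  let φ : (⨂[K]^n (κ → K)) →ₗ[K] K :=
    PiTensorProduct.dualDistrib (PiTensorProduct.tprod K fun i => LinearMap.proj (w i))
  have hφ : ∀ x : Fin n → κ → K, φ (PiTensorProduct.tprod K x) = ∏ i, x i (w i) := fun x =>
    PiTensorProduct.dualDistrib_apply _ _
  permRetract (H := H)
    (X := (tensorPowerFunctor K n).obj ⟨FGModuleCat.of K (κ → K)⟩)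
    ⟨PiTensorProduct.tprod K fun i => Pi.single (w i) 1, fun σ => by
      refine (permRep_tprod σ.1 _).trans ?_
      congr 1
      funext i
      have h := (hH _).1 (H.inv_mem σ.2) i
      exact congrArg (fun k : κ => (Pi.single k 1 : κ → K)) h⟩
    (Representation.Coinvariants.lift _ φ fun σ => by
      refine PiTensorProduct.ext (MultilinearMap.ext fun x => ?_)
      refine (congrArg φ (permRep_tprod σ.1 x)).trans ?_
      refine (hφ _).trans (Eq.trans ?_ (hφ _).symm)
      rw [← Equiv.prod_comp σ.1]
      refine Finset.prod_congr rfl fun i _ => ?_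
      rw [Equiv.symm_apply_apply, (hH _).1 σ.2 i])
    (fun σ hσ => by
      refine (congrArg φ (permRep_tprod σ _)).trans ((hφ _).trans ?_)
      refine Finset.prod_eq_one fun i _ => ?_
      have h := (hH _).1 (H.inv_mem hσ) i
      refine Eq.trans (congrArg (fun k : κ => (Pi.single k 1 : κ → K) (w i)) h) ?_
      exact Pi.single_eq_same _ _)
    (fun σ hσ => by
      refine (congrArg φ (permRep_tprod σ _)).trans ((hφ _).trans ?_)
      obtain ⟨i, hi⟩ : ∃ i, w (σ i) ≠ w i := by
        by_contra! hcon
        exact hσ ((hH σ).2 hcon)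
      -- In position `σ i` the tensor `σ e_w` has the factor `e_{w i}`, whose coordinate at `w (σ
      -- i)` vanishes.
      refine Finset.prod_eq_zero (Finset.mem_univ (σ i)) ?_
      rw [Equiv.symm_apply_apply]
      exact Pi.single_eq_of_ne hi _)

end LevelRetract

/-! ### Tensor products of functors of coinvariants and of invariants. -/

section TensorCoinvariants

variable {K : Type u} [Field K] {m n : ℕ}

/-- Maps compatible with families of linear maps are compatible with their tensor products. -/
lemma map_homTensorHomMap {P Q A A' B B' C C' D D' : Type*} [AddCommGroup P] [Module K P]
    [AddCommGroup Q] [Module K Q] [AddCommGroup A] [Module K A] [AddCommGroup A'] [Module K A']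
    [AddCommGroup B] [Module K B] [AddCommGroup B'] [Module K B'] [AddCommGroup C] [Module K C]
    [AddCommGroup C'] [Module K C'] [AddCommGroup D] [Module K D] [AddCommGroup D'] [Module K D']
    (Φ : P →ₗ[K] A →ₗ[K] B) (Φ' : P →ₗ[K] A' →ₗ[K] B') (Ψ : Q →ₗ[K] C →ₗ[K] D)
    (Ψ' : Q →ₗ[K] C' →ₗ[K] D') (α : A →ₗ[K] A') (β : B →ₗ[K] B') (γ : C →ₗ[K] C')
    (δ : D →ₗ[K] D') (h : ∀ p x, β (Φ p x) = Φ' p (α x)) (h' : ∀ q y, δ (Ψ q y) = Ψ' q (γ y))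
    (a : P ⊗[K] Q) (z : A ⊗[K] C) :
    TensorProduct.map β δ
        (TensorProduct.homTensorHomMap (RingHom.id K) A C B D (TensorProduct.map Φ Ψ a) z) =
      TensorProduct.homTensorHomMap (RingHom.id K) A' C' B' D' (TensorProduct.map Φ' Ψ' a)
        (TensorProduct.map α γ z) := by
  induction a with
  | zero => simp
  | tmul p q =>
    induction z using TensorProduct.induction_on with
    | zero => simp
    | tmul x y => simp [h, h']
    | add x y hx hy => simp only [map_add, hx, hy]
  | add a b ha hb => simp only [map_add, LinearMap.add_apply, ha, hb]

/-- Isomorphic functors have isomorphic tensor products with a given functor. -/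
def polyTensorIso (F : StrictPolyFunctor K m) {G G' : StrictPolyFunctor K n} (e : G ≅ G') :
    polyTensor F G ≅ polyTensor F G' :=
  LinFunctor.isoLin (F := polyTensor F G) (G := polyTensor F G')
    (fun V => TensorProduct.congr (LinearEquiv.refl K (F.obj.obj ⟨V.space⟩))
      (LinFunctor.isoApp e ⟨V.space⟩))
    (fun {V W} f x => map_homTensorHomMap (F.mapLin ⟨V.space⟩ ⟨W.space⟩)
      (F.mapLin ⟨V.space⟩ ⟨W.space⟩) (G.mapLin ⟨V.space⟩ ⟨W.space⟩)
      (G'.mapLin ⟨V.space⟩ ⟨W.space⟩) LinearMap.id LinearMap.id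
      (LinFunctor.isoApp e ⟨V.space⟩).toLinearMap (LinFunctor.isoApp e ⟨W.space⟩).toLinearMap
      (fun _ _ => rfl)
      (fun g y => LinFunctor.isoApp_naturality e (X := ⟨V.space⟩) (Y := ⟨W.space⟩) g y)
      (comul m n (V.space →ₗ[K] W.space) f) x)

variable {V W X : Type u} [AddCommGroup V] [Module K V] [AddCommGroup W] [Module K W]
  [AddCommGroup X] [Module K X]

lemma mulEquiv_perm (σ : Equiv.Perm (Fin m)) (τ : Equiv.Perm (Fin n))
    (z : (⨂[K]^m X) ⊗[K] (⨂[K]^n X)) :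
    TensorPower.mulEquiv (TensorProduct.map (permRep K m X σ) (permRep K n X τ) z) =
      permRep K (m + n) X (finSumFinEquiv.permCongr (Equiv.sumCongr σ τ))
        (TensorPower.mulEquiv z) := by
  rw [← LinearEquiv.eq_symm_apply, mulEquiv_symm_perm, LinearEquiv.symm_apply_apply]

/-- The comultiplication is the restriction of the splitting of a tensor power, so acting on
`V^{⊗(m+n)}` agrees with acting on `V^{⊗m} ⊗ V^{⊗n}` through `comul`. This is the naturality behind
both identifications below. -/
lemma mulEquiv_symm_powAct (f : DivPow K (m + n) (V →ₗ[K] W)) (x : ⨂[K]^(m + n) V) :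
    TensorPower.mulEquiv.symm (powAct (m + n) f.1 x) =
      TensorProduct.homTensorHomMap (RingHom.id K) _ _ _ _
        (TensorProduct.map (powAct m ∘ₗ (DivPow K m (V →ₗ[K] W)).subtype)
          (powAct n ∘ₗ (DivPow K n (V →ₗ[K] W)).subtype) (comul m n _ f))
        (TensorPower.mulEquiv.symm x) := by
  rw [TensorProduct.map_comp, LinearMap.comp_apply]
  refine Eq.trans ?_ (congrArg (fun z => TensorProduct.homTensorHomMap (RingHom.id K) _ _ _ _
    (TensorProduct.map (powAct m) (powAct n) z) _) (mapIncl_comul m n f).symm)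
  -- After `mapIncl_comul` only the underlying tensor matters, so invariance can be dropped and the
  -- tensor taken to be pure.
  generalize f.1 = f
  induction f using ind with
  | h f =>
    induction x using ind with
    | h g => simp only [powAct_tprod, mulEquiv_symm_tprod, TensorProduct.homTensorHomMap_apply,
        TensorProduct.map_tmul]
    | hs c x hx => simp only [map_smul, hx]
    | ha x y hx hy => simp only [map_add, hx, hy]
  | hs c x hx => simp only [map_smul, hx, LinearMap.smul_apply]
  | ha x y hx hy => simp only [map_add, hx, hy, LinearMap.add_apply]

/-- The `H`-coinvariants of `X^{⊗ n}`. -/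
abbrev powCoinvariants (H : Subgroup (Equiv.Perm (Fin n))) (X : Type u) [AddCommGroup X]
    [Module K X] : Type u :=
  Representation.Coinvariants ((permRep K n X).comp H.subtype)

/-- The projection of `X^{⊗ n}` to its `H`-coinvariants. -/
abbrev powMk (H : Subgroup (Equiv.Perm (Fin n))) (X : Type u) [AddCommGroup X]
    [Module K X] : (⨂[K]^n X) →ₗ[K] powCoinvariants (K := K) H X :=
  Representation.Coinvariants.mk ((permRep K n X).comp H.subtype)

variable {H : Subgroup (Equiv.Perm (Fin m))} {H' : Subgroup (Equiv.Perm (Fin n))}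
  {Y : Subgroup (Equiv.Perm (Fin (m + n)))}

lemma powMk_permRep (σ : Equiv.Perm (Fin n)) (hσ : σ ∈ H') (x : ⨂[K]^n X) :
    powMk H' X (permRep K n X σ x) = powMk H' X x :=
  Representation.Coinvariants.mk_self_apply ((permRep K n X).comp H'.subtype) ⟨σ, hσ⟩ x

/-- `X^{⊗ m}_H ⊗ X^{⊗ n}_{H'} ≅ X^{⊗ (m+n)}_{H × H'}`. -/
def tensorCoinvariantsEquiv (hY : ∀ σ, σ ∈ Y ↔ ∃ τ ∈ H, ∃ τ' ∈ H',
      finSumFinEquiv.permCongr (Equiv.sumCongr τ τ') = σ) (X : Type u) [AddCommGroup X]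
    [Module K X] :
    powCoinvariants (K := K) Y X ≃ₗ[K]
      (powCoinvariants (K := K) H X) ⊗[K] (powCoinvariants (K := K) H' X) :=
  LinearEquiv.ofLinearMap
    (Representation.Coinvariants.lift _
      (TensorProduct.map (powMk H X) (powMk H' X) ∘ₗ TensorPower.mulEquiv.symm.toLinearMap)
      (fun σ => LinearMap.ext fun x => by
        obtain ⟨τ, hτ, τ', hτ', h⟩ := (hY σ.1).1 σ.2
        change TensorProduct.map (powMk H X) (powMk H' X) (TensorPower.mulEquiv.symm
          (permRep K (m + n) X σ.1 x)) = TensorProduct.map (powMk H X) (powMk H' X)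
            (TensorPower.mulEquiv.symm x)
        rw [← h, mulEquiv_symm_perm]
        generalize TensorPower.mulEquiv.symm x = z
        induction z with
        | zero => simp
        | tmul x y => rw [TensorProduct.map_tmul, TensorProduct.map_tmul, TensorProduct.map_tmul,
            powMk_permRep τ hτ, powMk_permRep τ' hτ']
        | add x y hx hy => simp only [map_add, hx, hy]))
    -- The inverse is obtained by descending the multiplication map to coinvariants in one variable
    -- at a time; the elements `(τ, 1)` and `(1, τ')` of `Y` justify the two descents.
    (TensorProduct.lift (LinearMap.flip (Representation.Coinvariants.lift _ (LinearMap.flip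
      (Representation.Coinvariants.lift _ ((TensorProduct.mk K _ _).compr₂
        (powMk Y X ∘ₗ TensorPower.mulEquiv.toLinearMap)) (fun τ => by
          refine LinearMap.ext fun x => LinearMap.ext fun y => ?_
          have h := mulEquiv_perm τ.1 1 (x ⊗ₜ y)
          rw [TensorProduct.map_tmul, map_one] at h
          exact (congrArg (powMk Y X) h).trans
            (powMk_permRep _ ((hY _).2 ⟨τ.1, τ.2, 1, H'.one_mem, rfl⟩) _))))
        (fun τ' => by
          refine LinearMap.ext fun y => Representation.Coinvariants.hom_ext
            (LinearMap.ext fun x => ?_)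
          have h := mulEquiv_perm 1 τ'.1 (x ⊗ₜ y)
          rw [TensorProduct.map_tmul, map_one] at h
          exact (congrArg (powMk Y X) h).trans
            (powMk_permRep _ ((hY _).2 ⟨1, H.one_mem, τ'.1, τ'.2, rfl⟩) _)))))
    (by
      refine TensorProduct.ext (Representation.Coinvariants.hom_ext (LinearMap.ext fun x =>
        Representation.Coinvariants.hom_ext (LinearMap.ext fun y => ?_)))
      exact congrArg (TensorProduct.map (powMk H X) (powMk H' X))
        (TensorPower.mulEquiv.symm_apply_apply (x ⊗ₜ y)))
    (by
      refine Representation.Coinvariants.hom_ext (LinearMap.ext fun x => ?_)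
      obtain ⟨z, rfl⟩ := TensorPower.mulEquiv.surjective x
      simp only [LinearMap.comp_apply, Representation.Coinvariants.lift_mk, LinearEquiv.coe_coe,
        LinearEquiv.symm_apply_apply, LinearMap.id_apply]
      induction z with
      | zero => simp
      | tmul x y => rfl
      | add x y hx hy => simp only [map_add, hx, hy])

/-- `j^* H₀(H, -) ⊗ j^* H₀(H', -) ≅ j^* H₀(H × H', -)`. -/
def tensorCoinvariantsIso (hY : ∀ σ, σ ∈ Y ↔ ∃ τ ∈ H, ∃ τ' ∈ H',
      finSumFinEquiv.permCongr (Equiv.sumCongr τ τ') = σ) :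
    (jPull K (m + n)).obj (H0lower Y) ≅
      polyTensor ((jPull K m).obj (H0lower H)) ((jPull K n).obj (H0lower H')) :=
  LinFunctor.isoLin (fun V => tensorCoinvariantsEquiv hY V.space) (fun {V W} f x => by
    induction x using Representation.Coinvariants.induction_on with
    | h x =>
      exact (congrArg (TensorProduct.map (powMk H W.space) (powMk H' W.space))
        (mulEquiv_symm_powAct f x)).trans (map_homTensorHomMap _
          (((jPull K m).obj (H0lower H)).mapLin ⟨V.space⟩ ⟨W.space⟩) _
          (((jPull K n).obj (H0lower H')).mapLin ⟨V.space⟩ ⟨W.space⟩)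
          (powMk H V.space) (powMk H W.space) (powMk H' V.space) (powMk H' W.space)
          (fun _ _ => rfl) (fun _ _ => rfl) _ _))

/-- The `H`-invariants of `X^{⊗ n}`. -/
abbrev powInvariants (H : Subgroup (Equiv.Perm (Fin n))) (X : Type u) [AddCommGroup X]
    [Module K X] : Submodule K (⨂[K]^n X) :=
  Representation.invariants ((permRep K n X).comp H.subtype)

lemma mulEquiv_mapIncl_mem (hY : ∀ σ, σ ∈ Y ↔ ∃ τ ∈ H, ∃ τ' ∈ H',
      finSumFinEquiv.permCongr (Equiv.sumCongr τ τ') = σ)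
    (z : (powInvariants (K := K) H X) ⊗[K] (powInvariants (K := K) H' X)) :
    TensorPower.mulEquiv (TensorProduct.mapIncl (powInvariants (K := K) H X)
      (powInvariants (K := K) H' X) z) ∈ powInvariants (K := K) Y X := by
  intro σ
  obtain ⟨τ, hτ, τ', hτ', h⟩ := (hY σ.1).1 σ.2
  change permRep K (m + n) X σ.1 _ = _
  rw [← h, ← mulEquiv_perm]
  congr 1
  induction z with
  | zero => simp
  | tmul x y => exact congrArg₂ (· ⊗ₜ[K] ·) (x.2 ⟨τ, hτ⟩) (y.2 ⟨τ', hτ'⟩)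
  | add x y hx hy => simp only [map_add, hx, hy]

/-- `(X^{⊗ m})^H ⊗ (X^{⊗ n})^{H'} ≅ (X^{⊗ (m+n)})^{H × H'}`. -/
def tensorInvariantsEquiv (hY : ∀ σ, σ ∈ Y ↔ ∃ τ ∈ H, ∃ τ' ∈ H',
      finSumFinEquiv.permCongr (Equiv.sumCongr τ τ') = σ) (X : Type u) [AddCommGroup X]
    [Module K X] :
    (powInvariants (K := K) H X) ⊗[K] (powInvariants (K := K) H' X) ≃ₗ[K]
      powInvariants (K := K) Y X :=
  LinearEquiv.ofBijective
    ((TensorPower.mulEquiv.toLinearMap ∘ₗ TensorProduct.mapIncl (powInvariants (K := K) H X)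
      (powInvariants (K := K) H' X)).codRestrict _ (mulEquiv_mapIncl_mem hY)) (by
    constructor
    · have h1 : Function.Injective (TensorProduct.mapIncl (powInvariants (K := K) H X)
          (powInvariants (K := K) H' X)) :=
        TensorProduct.map_injective_of_flat_flat _ _
          (Submodule.subtype_injective _) (Submodule.subtype_injective _)
      exact fun x y hxy => h1 ((TensorPower.mulEquiv (R := K) (M := X)).injective
        (congrArg Subtype.val hxy))
    -- Invariance under `H × 1` and under `1 × H'` separately puts the tensor in the product of the
    -- two invariant subspaces; this is `mem_range_of_both`, which rests on flatness over a field.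
    · intro x
      obtain ⟨z, hz⟩ := mem_range_of_both ((permRep K m X).comp H.subtype)
        ((permRep K n X).comp H'.subtype) (TensorPower.mulEquiv.symm x.1)
        (fun τ => by
          have h := mulEquiv_symm_perm τ.1 1 x.1
          rw [map_one] at h
          exact h.symm.trans (congrArg TensorPower.mulEquiv.symm
            (x.2 ⟨_, (hY _).2 ⟨τ.1, τ.2, 1, H'.one_mem, rfl⟩⟩)))
        (fun τ' => by
          have h := mulEquiv_symm_perm 1 τ'.1 x.1
          rw [map_one] at h
          exact h.symm.trans (congrArg TensorPower.mulEquiv.symm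
            (x.2 ⟨_, (hY _).2 ⟨1, H.one_mem, τ'.1, τ'.2, rfl⟩⟩)))
      exact ⟨z, Subtype.ext ((congrArg TensorPower.mulEquiv hz).trans
        (LinearEquiv.apply_symm_apply _ _))⟩)

/-- `j^* H⁰(H, -) ⊗ j^* H⁰(H', -) ≅ j^* H⁰(H × H', -)`. -/
def tensorInvariantsIso (hY : ∀ σ, σ ∈ Y ↔ ∃ τ ∈ H, ∃ τ' ∈ H',
      finSumFinEquiv.permCongr (Equiv.sumCongr τ τ') = σ) :
    polyTensor ((jPull K m).obj (H0upper H)) ((jPull K n).obj (H0upper H')) ≅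
      (jPull K (m + n)).obj (H0upper Y) :=
  LinFunctor.isoLin (fun V => tensorInvariantsEquiv hY V.space) (fun {V W} f x => by
    refine Subtype.ext (TensorPower.mulEquiv.symm.injective ?_)
    refine (LinearEquiv.symm_apply_apply _ _).trans
      (Eq.trans ?_ (mulEquiv_symm_powAct f _).symm)
    refine Eq.trans ?_ (congrArg _ (LinearEquiv.symm_apply_apply _ _).symm)
    exact map_homTensorHomMap
      (((jPull K m).obj (H0upper H)).mapLin ⟨V.space⟩ ⟨W.space⟩) _
      (((jPull K n).obj (H0upper H')).mapLin ⟨V.space⟩ ⟨W.space⟩) _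
      (powInvariants H V.space).subtype (powInvariants H W.space).subtype
      (powInvariants H' V.space).subtype (powInvariants H' W.space).subtype
      (fun _ _ => rfl) (fun _ _ => rfl) (comul m n (V.space →ₗ[K] W.space) f) x)

end TensorCoinvariants

/-! ### Young subgroups, and `S^λ` and `Γ^λ` as restrictions along tensor powers. -/

section Blocks

/-- The extension of `w` to `Fin (a + s)` which is zero on the first `a` elements and `w + 1` on the
others. -/
def consIndex (a : ℕ) {s : ℕ} (w : Fin s → ℕ) : Fin (a + s) → ℕ :=
  Fin.addCases (motive := fun _ => ℕ) (fun _ => 0) (fun j => w j + 1)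

lemma consIndex_castAdd (a : ℕ) {s : ℕ} (w : Fin s → ℕ) (j : Fin a) :
    consIndex a w (Fin.castAdd s j) = 0 :=
  Fin.addCases_left (motive := fun _ => ℕ) j

lemma consIndex_natAdd (a : ℕ) {s : ℕ} (w : Fin s → ℕ) (j : Fin s) :
    consIndex a w (Fin.natAdd a j) = w j + 1 :=
  Fin.addCases_right (motive := fun _ => ℕ) j

/-- The index of the block of `i` in the decomposition of `{0, …, l.sum - 1}` into consecutive
blocks with lengths the entries of `l`. -/
def blockIndex : (l : List ℕ) → Fin l.sum → ℕ
  | [] => fun _ => 0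
  | a :: l => consIndex a (blockIndex l)

/-- These partial-sum inequalities are the ones that determine `Composition.index`; they link it to
the recursion along the list. -/
lemma sum_take_blockIndex (l : List ℕ) (i : Fin l.sum) :
    (l.take (blockIndex l i)).sum ≤ i ∧ (i : ℕ) < (l.take (blockIndex l i + 1)).sum := by
  induction l with
  | nil => exact i.elim0
  | cons a l ih =>
    refine Fin.addCases (m := a) (n := l.sum) (motive := fun i =>
      ((a :: l).take (consIndex a (blockIndex l) i)).sum ≤ i ∧
        (i : ℕ) < ((a :: l).take (consIndex a (blockIndex l) i + 1)).sum)
        (fun j => ?_) (fun j => ?_) i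
    · rw [consIndex_castAdd]
      simp
    · rw [consIndex_natAdd]
      have h := ih j
      simp only [List.take_succ_cons, List.sum_cons, Fin.val_natAdd]
      omega

/-- The partial sums are monotone, so the half-open intervals between consecutive ones are disjoint.
-/
lemma composition_index_eq {n : ℕ} (c : Composition n) (i : Fin n) (k : ℕ)
    (h1 : c.sizeUpTo k ≤ i) (h2 : (i : ℕ) < c.sizeUpTo (k + 1)) : (c.index i : ℕ) = k := by
  have h3 := c.sizeUpTo_index_le i
  have h4 : (i : ℕ) < c.sizeUpTo (c.index i + 1) := c.lt_sizeUpTo_index_succ i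
  rcases lt_trichotomy (c.index i : ℕ) k with h | h | h
  · have := c.monotone_sizeUpTo (show (c.index i : ℕ) + 1 ≤ k from h)
    omega
  · exact h
  · have := c.monotone_sizeUpTo (show k + 1 ≤ (c.index i : ℕ) from h)
    omega

/-- The subgroup of the permutations preserving a function. -/
def levelSubgroup {n : ℕ} {κ : Type} (w : Fin n → κ) : Subgroup (Equiv.Perm (Fin n)) where
  carrier := {σ | ∀ i, w (σ i) = w i}
  mul_mem' {σ τ} hσ hτ i := (hσ (τ i)).trans (hτ i)
  one_mem' _ := rfl
  inv_mem' {σ} hσ i := by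
    have h := hσ (σ.symm i)
    rw [Equiv.apply_symm_apply] at h
    exact h.symm

/-- The first block is the zero level of `consIndex a w`, since all later values are shifted by one.
A permutation preserving the levels therefore preserves this block and splits as a sum, whose second
part preserves `w`. -/
lemma mem_levelSubgroup_cons (a : ℕ) {s : ℕ} (w : Fin s → ℕ) (σ : Equiv.Perm (Fin (a + s))) :
    σ ∈ levelSubgroup (consIndex a w) ↔
      ∃ τ ∈ (⊤ : Subgroup (Equiv.Perm (Fin a))), ∃ τ' ∈ levelSubgroup w,
        finSumFinEquiv.permCongr (Equiv.sumCongr τ τ') = σ := by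
  constructor
  · intro hσ
    let ρ : Equiv.Perm (Fin a ⊕ Fin s) := finSumFinEquiv.symm.permCongr σ
    have hρ : ∀ x, finSumFinEquiv (ρ x) = σ (finSumFinEquiv x) := fun x => by
      simp [ρ, Equiv.permCongr_apply]
    have hm : Set.MapsTo ρ (Set.range Sum.inl) (Set.range Sum.inl) := by
      rintro _ ⟨j, rfl⟩
      rcases h : ρ (Sum.inl j) with k | k
      · exact ⟨k, rfl⟩
      · have h1 := hρ (Sum.inl j)
        rw [h, finSumFinEquiv_apply_left, finSumFinEquiv_apply_right] at h1
        have h2 : consIndex a w (σ (Fin.castAdd s j)) =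
          consIndex a w (Fin.castAdd s j) := hσ (Fin.castAdd s j)
        rw [← h1, consIndex_castAdd, consIndex_natAdd] at h2
        omega
    obtain ⟨⟨τ, τ'⟩, h⟩ := Equiv.Perm.mem_sumCongrHom_range_of_perm_mapsTo_inl hm
    have h' : Equiv.sumCongr τ τ' = ρ := h
    refine ⟨τ, Subgroup.mem_top _, τ', fun j => ?_, ?_⟩
    · have h1 := hρ (Sum.inr j)
      rw [← h', Equiv.sumCongr_apply, Sum.map_inr, finSumFinEquiv_apply_right,
        finSumFinEquiv_apply_right] at h1
      have h2 : consIndex a w (σ (Fin.natAdd a j)) =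
          consIndex a w (Fin.natAdd a j) := hσ (Fin.natAdd a j)
      rw [← h1, consIndex_natAdd, consIndex_natAdd] at h2
      omega
    · rw [h']
      ext i
      simp [ρ, Equiv.permCongr_apply]
  · rintro ⟨τ, -, τ', hτ', rfl⟩ i
    obtain ⟨x, rfl⟩ := finSumFinEquiv.surjective i
    rw [Equiv.permCongr_apply, Equiv.symm_apply_apply]
    rcases x with j | j
    · rw [Equiv.sumCongr_apply, Sum.map_inl, finSumFinEquiv_apply_left, finSumFinEquiv_apply_left,
        consIndex_castAdd, consIndex_castAdd]
    · rw [Equiv.sumCongr_apply, Sum.map_inr, finSumFinEquiv_apply_right,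
        finSumFinEquiv_apply_right, consIndex_natAdd, consIndex_natAdd, hτ' j]

variable (K : Type u) [Field K]

lemma levelSubgroup_nil : levelSubgroup (blockIndex []) = ⊤ :=
  top_unique fun _ _ _ => rfl

/-- `S^{n₁} ⊗ ⋯ ⊗ S^{n_k}` as the functor of coinvariants of tensor powers. -/
def symmetricListIso : (l : List ℕ) →
    (symmetricList K l ≅ (jPull K l.sum).obj (H0lower (levelSubgroup (blockIndex l))))
  | [] => eqToIso (by rw [levelSubgroup_nil]; rfl)
  | a :: l => polyTensorIso (symmetricPower K a) (symmetricListIso l) ≪≫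
      (tensorCoinvariantsIso (mem_levelSubgroup_cons a (blockIndex l))).symm

/-- `Γ^{n₁} ⊗ ⋯ ⊗ Γ^{n_k}` as the functor of invariants of tensor powers. -/
def dividedListIso : (l : List ℕ) →
    (dividedList K l ≅ (jPull K l.sum).obj (H0upper (levelSubgroup (blockIndex l))))
  | [] => eqToIso (by rw [levelSubgroup_nil]; rfl)
  | a :: l => polyTensorIso (dividedPower K a) (dividedListIso l) ≪≫
      tensorInvariantsIso (mem_levelSubgroup_cons a (blockIndex l))

/-- The index of a composition and the recursive index satisfy the same inequalities, hence agree.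
This matches the Young subgroup with the subgroup produced by the induction on parts. -/
lemma levelSubgroup_index (l : List ℕ) (h : ∀ {i}, i ∈ l → 0 < i) :
    levelSubgroup (Composition.index ⟨l, h, rfl⟩) = levelSubgroup (blockIndex l) := by
  have key : ∀ i : Fin l.sum, ((Composition.index ⟨l, h, rfl⟩ i : Fin _) : ℕ) = blockIndex l i :=
    fun i => composition_index_eq _ i _ (sum_take_blockIndex l i).1 (sum_take_blockIndex l i).2
  ext σ
  refine forall_congr' fun i => ?_
  rw [Fin.ext_iff, key, key]

/-- Stated for all compositions of a free `n`, so that `n` can be replaced by the sum of the list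
and the transport along `blocks_sum` becomes trivial. -/
lemma nonempty_symmetric_composition_iso {n : ℕ} (c : Composition n) :
    Nonempty ((c.blocks_sum ▸ symmetricList K c.blocks : StrictPolyFunctor K n) ≅
      (jPull K n).obj (H0lower (levelSubgroup c.index))) := by
  obtain ⟨l, h, rfl⟩ := c
  rw [levelSubgroup_index l h]
  exact ⟨symmetricListIso K l⟩

lemma nonempty_divided_composition_iso {n : ℕ} (c : Composition n) :
    Nonempty ((c.blocks_sum ▸ dividedList K c.blocks : StrictPolyFunctor K n) ≅
      (jPull K n).obj (H0upper (levelSubgroup c.index))) := by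
  obtain ⟨l, h, rfl⟩ := c
  rw [levelSubgroup_index l h]
  exact ⟨dividedListIso K l⟩

variable {n : ℕ} (lam : n.Partition)

/-- `S^λ ≅ j^* H₀(𝔖_λ, -)`. -/
def symmetricPartIso :
    symmetricPart K lam ≅ (jPull K n).obj (H0lower (youngSubgroup lam)) :=
  (nonempty_symmetric_composition_iso K (partComp lam)).some

/-- `Γ^λ ≅ j^* H⁰(𝔖_λ, -)`. -/
def dividedPartIso :
    dividedPart K lam ≅ (jPull K n).obj (H0upper (youngSubgroup lam)) :=
  (nonempty_divided_composition_iso K (partComp lam)).some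

/-- `K[𝔖ₙ/𝔖_λ]` is a retract of a tensor power. -/
def youngRetract : Retract (youngModule K lam) ((tensorPowerFunctor K n).obj
    ⟨FGModuleCat.of K (Fin (partComp lam).length → K)⟩) :=
  levelRetract K (partComp lam).index (youngSubgroup lam) fun _ => Iff.rfl

end Blocks

/-! ### Duality between invariants and coinvariants. -/

section Duality

variable {K : Type u} [Field K]

/-- A perfect invariant pairing identifies invariants with functionals on coinvariants. -/
def invariantsDualEquiv {H A B : Type*} [Group H] [AddCommGroup A] [Module K A] [AddCommGroup B]
    [Module K B] (ρ : Representation K H A) (τ : Representation K H B)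
    (P : B ≃ₗ[K] Module.Dual K A) (hP : ∀ h a b, P (τ h b) (ρ h a) = P b a) :
    τ.invariants ≃ₗ[K] Module.Dual K ρ.Coinvariants where
  toFun b := Representation.Coinvariants.lift ρ (P b.1) (fun h => LinearMap.ext fun a => by
    have h1 := hP h a b.1
    rw [b.2 h] at h1
    exact h1)
  map_add' b c := Representation.Coinvariants.hom_ext (LinearMap.ext fun a =>
    LinearMap.congr_fun (map_add P b.1 c.1) a)
  map_smul' r b := Representation.Coinvariants.hom_ext (LinearMap.ext fun a =>
    LinearMap.congr_fun (map_smul P r b.1) a)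
  invFun ζ := ⟨P.symm (ζ ∘ₗ Representation.Coinvariants.mk ρ), fun h => P.injective (by
    refine LinearMap.ext fun a => ?_
    obtain ⟨a, rfl⟩ : ∃ a', ρ h a' = a := ⟨ρ h⁻¹ a, by
      rw [← Module.End.mul_apply, ← map_mul, mul_inv_cancel, map_one]; rfl⟩
    rw [hP, LinearEquiv.apply_symm_apply, LinearMap.comp_apply, LinearMap.comp_apply,
      Representation.Coinvariants.mk_self_apply])⟩
  left_inv b := Subtype.ext (P.symm_apply_eq.2 (LinearMap.ext fun _ => rfl))
  right_inv ζ := Representation.Coinvariants.hom_ext (LinearMap.ext fun a =>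
    LinearMap.congr_fun (P.apply_symm_apply (ζ ∘ₗ Representation.Coinvariants.mk ρ)) a)

/-- `H⁰(H, -)` is the dual of `H₀(H, -)`. -/
def H0upperDualIso {G : Type} [Group G] (H : Subgroup G) :
    (H0upper H : RepFunctor K G) ≅ repDuality.obj (Opposite.op (H0lower H)) :=
  LinFunctor.isoLin
    (fun M => invariantsDualEquiv
      ((rep (dualRep.obj (Opposite.op M))).comp H.subtype) ((rep M).comp H.subtype)
      -- The pairing is evaluation of `M*` on `M`; it is invariant because `h` acts on `M*` through
      -- `h⁻¹`.
      (Module.evalEquiv K M) (fun h (a : Module.Dual K M) b => by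
        change a (rep M h.1⁻¹ (rep M h.1 b)) = a b
        rw [rep_inv_rep]))
    (fun f x => Representation.Coinvariants.hom_ext (LinearMap.ext fun a => rfl))

variable {n : ℕ} {V W : Type u} [AddCommGroup V] [Module K V] [AddCommGroup W] [Module K W]

/-- On pure tensors the pairing is `∏ b_i(x_i)`, and permuting both arguments only reorders the
factors. -/
lemma dualDistrib_permRep (σ : Equiv.Perm (Fin n)) (x : ⨂[K]^n V) (b : ⨂[K]^n (Module.Dual K V)) :
    PiTensorProduct.dualDistrib (permRep K n _ σ b) (permRep K n V σ x) =
      PiTensorProduct.dualDistrib b x := by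
  induction b using ind with
  | h b =>
    induction x using ind with
    | h x =>
      rw [permRep_tprod, permRep_tprod, PiTensorProduct.dualDistrib_apply,
        PiTensorProduct.dualDistrib_apply]
      exact Equiv.prod_comp σ.symm (fun i => b i (x i))
    | hs c x hx => simp only [map_smul, hx]
    | ha x y hx hy => simp only [map_add, hx, hy]
  | hs c x hx => simp only [map_smul, hx, LinearMap.smul_apply]
  | ha x y hx hy => simp only [map_add, hx, hy, LinearMap.add_apply]

/-- Adjointness, factor by factor. It makes the duality between `j^* H₀` and `j^* H⁰` natural, the
action on `(V*)^{⊗n}` being through `divTranspose`. -/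
lemma dualDistrib_powAct (f : ⨂[K]^n (V →ₗ[K] W)) (x : ⨂[K]^n V)
    (b : ⨂[K]^n (Module.Dual K W)) :
    PiTensorProduct.dualDistrib b (powAct n f x) =
      PiTensorProduct.dualDistrib
        (powAct n (PiTensorProduct.map (fun _ : Fin n => Module.Dual.transpose (R := K)) f) b)
        x := by
  induction f using ind with
  | h f =>
    induction b using ind with
    | h b =>
      induction x using ind with
      | h x =>
        rw [PiTensorProduct.map_tprod, powAct_tprod, powAct_tprod,
          PiTensorProduct.dualDistrib_apply, PiTensorProduct.dualDistrib_apply]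
        rfl
      | hs c x hx => simp only [map_smul, hx]
      | ha x y hx hy => simp only [map_add, hx, hy]
    | hs c x hx => simp only [map_smul, hx, LinearMap.smul_apply]
    | ha x y hx hy => simp only [map_add, hx, hy, LinearMap.add_apply]
  | hs c x hx => simp only [map_smul, hx, LinearMap.smul_apply]
  | ha x y hx hy => simp only [map_add, hx, hy, LinearMap.add_apply]

/-- `((V*)^{⊗ n})^H ≅ ((V^{⊗ n})_H)*`. -/
def powInvariantsDualEquiv (H : Subgroup (Equiv.Perm (Fin n))) (V : Type u) [AddCommGroup V]
    [Module K V] [Module.Finite K V] :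
    powInvariants (K := K) H (Module.Dual K V) ≃ₗ[K]
      Module.Dual K (powCoinvariants (K := K) H V) :=
  invariantsDualEquiv _ _ PiTensorProduct.dualDistribEquiv
    (fun h a b => dualDistrib_permRep h.1 a b)

/-- `j^* H₀(H, -)` is the dual of `j^* H⁰(H, -)`. -/
def jPullH0lowerIso (H : Subgroup (Equiv.Perm (Fin n))) :
    (jPull K n).obj (H0lower H) ≅
      (polyDuality K n).obj (Opposite.op ((jPull K n).obj (H0upper H))) :=
  LinFunctor.isoLin
    -- `(V^{⊗n})_H` is identified with its bidual, and the inner dual with `((V*)^{⊗n})^H`.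
    (fun V => (Module.evalEquiv K (powCoinvariants (K := K) H V.space)).trans
      (powInvariantsDualEquiv H V.space).dualMap)
    (fun {V W} f x => by
      induction x using Representation.Coinvariants.induction_on with
      | h x => exact LinearMap.ext fun b => dualDistrib_powAct f.1 x b.1)

end Duality

/-! ### Assembly of the isomorphisms and their compatibility with composition. -/

section Main

lemma homCongr_comp (R : Type*) {C : Type*} [Category* C] [Semiring R] [Preadditive C] [Linear R C]
    {X Y Z X' Y' Z' : C} (e₁ : X ≅ X') (e₂ : Y ≅ Y') (e₃ : Z ≅ Z') (f : X ⟶ Y) (g : Y ⟶ Z) :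
    Linear.homCongr R e₁ e₃ (f ≫ g) = Linear.homCongr R e₁ e₂ f ≫ Linear.homCongr R e₂ e₃ g := by
  simp [Linear.homCongr_apply]

variable (K : Type u) [Field K] {n : ℕ} (lam mu nu : n.Partition)

/-- `j_*(S^λ) ≅ H₀(𝔖_λ, -)`. -/
def jPushSymmetricPartIso :
    (jPush K n).obj (symmetricPart K lam) ≅ H0lower (youngSubgroup lam) :=
  (jPush K n).mapIso (symmetricPartIso K lam) ≪≫
    ((isDualRepresented_H0lower K (youngSubgroup lam)).jPushIso (youngRetract K lam)).symm

/-- `𝔻(Γ^λ) ≅ j^* H₀(𝔖_λ, -)`. -/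
def dualDividedPartIso : (polyDuality K n).obj (Opposite.op (dividedPart K lam)) ≅
    (jPull K n).obj (H0lower (youngSubgroup lam)) :=
  (polyDuality K n).mapIso (dividedPartIso K lam).symm.op ≪≫ (jPullH0lowerIso _).symm

/-- `j_!(Γ^λ) ≅ H⁰(𝔖_λ, -)`. -/
def jShriekDividedPartIso :
    (jShriek K n).obj (dividedPart K lam) ≅ H0upper (youngSubgroup lam) :=
  -- `𝔻 j_*(𝔻 Γ^λ) ≅ 𝔻 j_* j^* H₀(𝔖_λ,-) ≅ 𝔻 H₀(𝔖_λ,-) ≅ H⁰(𝔖_λ,-)`.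
  repDuality.mapIso (((jPush K n).mapIso (dualDividedPartIso K lam) ≪≫
    ((isDualRepresented_H0lower K (youngSubgroup lam)).jPushIso (youngRetract K lam)).symm).symm.op)
    ≪≫ (H0upperDualIso _).symm

/-- `Hom(S^λ, S^μ) ≅ Hom(K[𝔖ₙ/𝔖_λ], K[𝔖ₙ/𝔖_μ])`. -/
def homSymmetricPartEquiv : (symmetricPart K lam ⟶ symmetricPart K mu) ≃ₗ[K]
    (youngModule K lam ⟶ youngModule K mu) :=
  ((Linear.homCongr K (symmetricPartIso K lam) (symmetricPartIso K mu)).trans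
    ((isDualRepresented_H0lower K (youngSubgroup mu)).precompEquiv (tensorPowerFunctor K n)
      (youngRetract K mu) (H0lower (youngSubgroup lam))).symm).trans
    (homH0lowerEquiv K (youngSubgroup lam) (youngSubgroup mu))

/-- `Hom(K[𝔖ₙ/𝔖_λ], K[𝔖ₙ/𝔖_μ]) ≅ Hom(Γ^μ, Γ^λ)`. -/
def homDividedPartEquiv : (youngModule K lam ⟶ youngModule K mu) ≃ₗ[K]
    (dividedPart K mu ⟶ dividedPart K lam) :=
  -- Frobenius reciprocity gives `Γ^λ ≅ j^* h_{K[𝔖ₙ/𝔖_λ]}`, so the contravariant Yoneda embedding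
  -- applies.
  (LinearEquiv.ofBijective (pullHom (youngModule K lam) (youngModule K mu))
    (pullHom_bijective _ _ (youngRetract K mu))).trans
    (Linear.homCongr K
      (dividedPartIso K mu ≪≫ (jPull K n).mapIso (H0upperIso K (youngSubgroup mu))).symm
      (dividedPartIso K lam ≪≫ (jPull K n).mapIso (H0upperIso K (youngSubgroup lam))).symm)

variable {K lam mu nu}

/-- Each of the three constituents respects composition: conjugation by the isomorphisms `S^λ ≅ j^*
H₀(𝔖_λ,-)`, the inverse of restriction, and `homH0lowerEquiv`. -/
lemma homSymmetricPartEquiv_comp (f : symmetricPart K lam ⟶ symmetricPart K mu)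
    (g : symmetricPart K mu ⟶ symmetricPart K nu) :
    homSymmetricPartEquiv K lam nu (f ≫ g) =
      homSymmetricPartEquiv K lam mu f ≫ homSymmetricPartEquiv K mu nu g := by
  exact (congrArg (homH0lowerEquiv K (youngSubgroup lam) (youngSubgroup nu))
    ((congrArg _ (homCongr_comp K _ (symmetricPartIso K mu) _ f g)).trans
      ((isDualRepresented_H0lower K (youngSubgroup mu)).precompEquiv_symm_comp _
        (isDualRepresented_H0lower K (youngSubgroup nu)) (youngRetract K mu) (youngRetract K nu)
        _ _))).trans (homH0lowerEquiv_comp _ _)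

/-- The reversal comes from the contravariance of `M ↦ j^* h_M`; conjugation by fixed isomorphisms
preserves the order. -/
lemma homDividedPartEquiv_comp (f : youngModule K lam ⟶ youngModule K mu)
    (g : youngModule K mu ⟶ youngModule K nu) :
    homDividedPartEquiv K lam nu (f ≫ g) =
      homDividedPartEquiv K mu nu g ≫ homDividedPartEquiv K lam mu f :=
  (congrArg _ (pullHom_comp f g)).trans (homCongr_comp K _ _ _ _ _)

end Main

end StrictPoly

end

theorem mainTheorem5 (p : ℕ) [Fact p.Prime] (K : Type u) [Field K] [CharP K p] (n : ℕ)
    (hn : 0 < n) :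
    (∀ lam : n.Partition,
      Nonempty ((jPush K n).obj (symmetricPart K lam) ≅ H0lower (youngSubgroup lam)) ∧
      Nonempty ((H0lower (youngSubgroup lam) : RepFunctor K (Equiv.Perm (Fin n))) ≅
        tObj (youngModule K lam)) ∧
      Nonempty ((jShriek K n).obj (dividedPart K lam) ≅ H0upper (youngSubgroup lam)) ∧
      Nonempty ((H0upper (youngSubgroup lam) : RepFunctor K (Equiv.Perm (Fin n))) ≅
        hObj (youngModule K lam))) ∧
    (∃ (Φ : ∀ lam mu : n.Partition,
          (symmetricPart K lam ⟶ symmetricPart K mu) ≃ₗ[K]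
            (youngModule K lam ⟶ youngModule K mu))
        (Ψ : ∀ lam mu : n.Partition,
          (youngModule K lam ⟶ youngModule K mu) ≃ₗ[K]
            (dividedPart K mu ⟶ dividedPart K lam)),
      (∀ (lam mu nu : n.Partition) (f : symmetricPart K lam ⟶ symmetricPart K mu)
        (g : symmetricPart K mu ⟶ symmetricPart K nu),
        Φ lam nu (f ≫ g) = Φ lam mu f ≫ Φ mu nu g) ∧
      (∀ (lam mu nu : n.Partition) (f : youngModule K lam ⟶ youngModule K mu)
        (g : youngModule K mu ⟶ youngModule K nu),
        Ψ lam nu (f ≫ g) = Ψ mu nu g ≫ Ψ lam mu f)) := by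
  refine ⟨fun lam => ⟨⟨jPushSymmetricPartIso K lam⟩, ⟨H0lowerIso K _⟩,
    ⟨jShriekDividedPartIso K lam⟩, ⟨H0upperIso K _⟩⟩,
    fun lam mu => homSymmetricPartEquiv K lam mu, fun lam mu => homDividedPartEquiv K lam mu,
    fun _ _ _ f g => homSymmetricPartEquiv_comp f g,
    fun _ _ _ f g => homDividedPartEquiv_comp f g⟩
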